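/- Let $\mathcal G$ be a finite metric graph (not necessarily connected; loops and multiple edges are allowed) with finite set $\mathcal E$ of external edges $e$, each identified with $I_e=[0,\infty)$, and finite set $\mathcal I$ of internal edges $i$, each identified with $I_i=[0,a_i]$, $a_i>0$. Let $\mathcal H=\bigoplus_{j\in\mathcal E\cup\mathcal I}L^2(I_j)$ and $\mathcal K=\mathbb C^{\mathcal E}\oplus\mathbb C^{\mathcal I}\oplus\mathbb C^{\mathcal I}$. Let $\mathcal D$ be the set of $\psi=(\psi_j)\in\mathcal H$ such that every $\psi_j$ and its derivative $\psi_j'$ are absolutely continuous (on compact subintervals of $I_j$) and $\psi_j''\in L^2(I_j)$. For $\psi\in\mathcal D$ put $$\underline\psi=\bigl(\{\psi_e(0)\}_{e\in\mathcal E},\{\psi_i(0)\}_{i\in\mathcal I},\{\psi_i(a_i)\}_{i\in\mathcal I}\bigr),\qquad \underline\psi'=\bigl(\{\psi_e'(0)\}_{e\in\mathcal E},\{\psi_i'(0)\}_{i\in\mathcal I},\{-\psi_i'(a_i)\}_{i\in\mathcal I}\bigr).$$ Let $\mathcal M\subset\mathcal K\oplus\mathcal K$ be a maximal isotropic subspace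 for the Hermitian symplectic form $\omega\bigl((u_1,v_1),(u_2,v_2)\bigr)=\langle u_1,v_2\rangle-\langle v_1,u_2\rangle$, and let $\Delta(\mathcal M,\underline a)$ be the operator $\psi\mapsto(\psi_j'')_j$ in $\mathcal H$ with domain $\{\psi\in\mathcal D:\ (\underline\psi,\underline\psi')\in\mathcal M\}$. Let $A,B$ be any linear maps $\mathcal K\to\mathcal K$ with $\mathcal M=\{(u,v)\in\mathcal K\oplus\mathcal K:\ Au+Bv=0\}$, and let $n_+(\mathcal M)$ be the number of positive eigenvalues, counting multiplicities, of the self-adjoint map $AB^\dagger$ (it does not depend on the choice of $A,B$). Then the number of negative eigenvalues of $-\Delta(\mathcal M,\underline a)$, counting multiplicities, is at most $n_+(\mathcal M)$. If moreover $\mathcal I=\emptyset$, then $-\Delta(\mathcal M,\underline a)$ has precisely $n_+(\mathcal M)$ negative eigenvalues, counting multiplicities. -/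

import Mathlib

open MeasureTheory Set Matrix

/-- A metric graph with vertex set `V`, external edges `E` and internal edges `I`.
Internal edges have an initial vertex, a terminal vertex (possibly equal) and a positive length;
external edges have a single (initial) vertex and infinite length. -/
structure MetricGraph (V E I : Type*) where
  initialVertex : I → V
  terminalVertex : I → V
  externalVertex : E → V
  len : I → ℝ
  len_pos : ∀ i, 0 < len i

/-- The index set of the boundary space `𝒦 = 𝒦_E ⊕ 𝒦_I⁽⁻⁾ ⊕ 𝒦_I⁽⁺⁾`. -/
abbrev BdryIdx (E I : Type*) := E ⊕ (I ⊕ I)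

/-- The boundary space `𝒦 ≅ ℂ^(|E| + 2|I|)`, whose scalar product is `star u ⬝ᵥ v`. -/
abbrev BdrySpace (E I : Type*) := BdryIdx E I → ℂ

section Symplectic

variable {E I : Type*} [Fintype E] [Fintype I]

/-- The Hermitian symplectic form `ω(p, q) = ⟨p, J q⟩` on `𝒦 ⊕ 𝒦`, where `J (u, v) = (v, -u)`. -/
def symplecticForm (p q : BdrySpace E I × BdrySpace E I) : ℂ :=
  star p.1 ⬝ᵥ q.2 + star p.2 ⬝ᵥ (-q.1)

/-- `M` is isotropic: the symplectic form vanishes identically on `M`. -/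
def IsIsotropic (M : Submodule ℂ (BdrySpace E I × BdrySpace E I)) : Prop :=
  ∀ p ∈ M, ∀ q ∈ M, symplecticForm p q = 0

/-- `M` is isotropic and not a proper subspace of a larger isotropic subspace. -/
def IsMaximalIsotropic (M : Submodule ℂ (BdrySpace E I × BdrySpace E I)) : Prop :=
  Maximal IsIsotropic M

/-- The subspace `ℳ(A, B) = Ker (A, B) = {(u, v) : A u + B v = 0}` of `𝒦 ⊕ 𝒦`. -/
def boundarySubspace (A B : Matrix (BdryIdx E I) (BdryIdx E I) ℂ) :
    Submodule ℂ (BdrySpace E I × BdrySpace E I) :=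
  LinearMap.ker (A.mulVecLin.coprod B.mulVecLin)

end Symplectic

open Classical in
/-- The number of positive real eigenvalues of a square complex matrix, counted with their
multiplicities as roots of the characteristic polynomial. -/
noncomputable def numPosEigenvalues {n : Type*} [Fintype n] [DecidableEq n]
    (T : Matrix n n ℂ) : ℕ :=
  (T.charpoly.roots.filter fun z => 0 < z.re ∧ z.im = 0).card

namespace LinearPMap

variable {H : Type*} [AddCommGroup H] [Module ℂ H]

/-- The space of all `x` in the domain of the operator `T` with `T x = μ x`. -/
def eigenspaceAt (T : H →ₗ.[ℂ] H) (μ : ℂ) : Submodule ℂ H where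
  carrier := {x | ∃ y : T.domain, (y : H) = x ∧ T y = μ • x}
  zero_mem' := ⟨0, by simp⟩
  add_mem' := by
    rintro _ _ ⟨y, rfl, hy⟩ ⟨z, rfl, hz⟩
    exact ⟨y + z, rfl, by rw [LinearPMap.map_add, hy, hz, smul_add]⟩
  smul_mem' := by
    rintro c _ ⟨y, rfl, hy⟩
    exact ⟨c • y, rfl, by rw [LinearPMap.map_smul, hy, smul_comm]⟩

/-- The number of negative eigenvalues of `T` counting multiplicities: the sum over all `μ < 0` of
the dimension of the eigenspace at `μ`. It is a cardinal, so it is meaningful without any a priori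
finiteness. -/
noncomputable def numNegEigenvalues (T : H →ₗ.[ℂ] H) : Cardinal :=
  Cardinal.sum fun μ : Iio (0 : ℝ) => Module.rank ℂ (T.eigenspaceAt ((μ : ℝ) : ℂ))

end LinearPMap

/-- On the closed interval `S`, the function `f` has the everywhere defined derivative `f'`
(one-sided at the endpoints), `f` and `f'` are absolutely continuous on every compact subinterval,
and `f''` is the almost everywhere derivative of `f'`. -/
structure HasTwoDerivsOn (S : Set ℝ) (f f' f'' : ℝ → ℂ) : Prop where
  ac : ∀ x ∈ S, ∀ y ∈ S, AbsolutelyContinuousOnInterval f x y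
  deriv : ∀ x ∈ S, HasDerivWithinAt f (f' x) S x
  ac_deriv : ∀ x ∈ S, ∀ y ∈ S, AbsolutelyContinuousOnInterval f' x y
  deriv_deriv : ∀ᵐ x ∂volume.restrict S, HasDerivAt f' (f'' x) x

namespace MetricGraph

variable {V E I : Type*} (G : MetricGraph V E I)

/-- The interval of an edge: `[0, ∞)` for an external edge, `[0, aᵢ]` for an internal edge. -/
def interval : E ⊕ I → Set ℝ
  | .inl _ => Ici 0
  | .inr i => Icc 0 (G.len i)

/-- The Hilbert space `⨁ⱼ L²(Iⱼ)`. -/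
abbrev L2Space := PiLp 2 fun j : E ⊕ I => Lp ℂ 2 (volume.restrict (G.interval j))

/-- The vector of boundary values `({ψₑ(0)}, {ψᵢ(0)}, {ψᵢ(aᵢ)})`. -/
def bdryValue (f : E ⊕ I → ℝ → ℂ) : BdrySpace E I
  | .inl e => f (.inl e) 0
  | .inr (.inl i) => f (.inr i) 0
  | .inr (.inr i) => f (.inr i) (G.len i)

/-- The vector of inward derivatives `({ψₑ'(0)}, {ψᵢ'(0)}, {-ψᵢ'(aᵢ)})`; the argument is `ψ'`. -/
def bdryDeriv (f' : E ⊕ I → ℝ → ℂ) : BdrySpace E I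
  | .inl e => f' (.inl e) 0
  | .inr (.inl i) => f' (.inr i) 0
  | .inr (.inr i) => -f' (.inr i) (G.len i)

theorem interval_subset_closure_interior (j : E ⊕ I) :
    G.interval j ⊆ closure (interior (G.interval j)) := by
  rcases j with e | i
  · simp [interval]
  · simp [interval, closure_Ioo (G.len_pos i).ne]

/-- `ψ` (with absolutely continuous representative `f` and derivative `f'`) has on every edge the
second derivative `η ∈ L²`, and the boundary data of `ψ` lie in `M`. -/
structure IsLaplacePair (M : Submodule ℂ (BdrySpace E I × BdrySpace E I))
    (ψ η : G.L2Space) (f f' : E ⊕ I → ℝ → ℂ) : Prop where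
  rep : ∀ j, ψ j =ᵐ[volume.restrict (G.interval j)] f j
  derivs : ∀ j, HasTwoDerivsOn (G.interval j) (f j) (f' j) (η j)
  bdry : (G.bdryValue f, G.bdryDeriv f') ∈ M

/-- The graph `{(ψ, ψ'') : ψ ∈ Dom Δ(M, a)}` of the Laplace operator. -/
def laplacianGraph (M : Submodule ℂ (BdrySpace E I × BdrySpace E I)) :
    Submodule ℂ (G.L2Space × G.L2Space) where
  carrier := {p | ∃ f f', G.IsLaplacePair M p.1 p.2 f f'}
  zero_mem' := by
    refine ⟨0, 0, fun j => Lp.coeFn_zero _ _ _, fun j => ⟨?_, ?_, ?_, ?_⟩, ?_⟩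
    · intro x _ y _
      exact ((LipschitzWith.const (0 : ℂ)).lipschitzOnWith).absolutelyContinuousOnInterval
    · intro x _
      exact hasDerivWithinAt_const x _ (0 : ℂ)
    · intro x _ y _
      exact ((LipschitzWith.const (0 : ℂ)).lipschitzOnWith).absolutelyContinuousOnInterval
    · filter_upwards [Lp.coeFn_zero ℂ 2 (volume.restrict (G.interval j))] with x hx
      have h := hasDerivAt_const x (0 : ℂ)
      have e : ((0 : G.L2Space × G.L2Space).2 j : ℝ → ℂ) x = 0 := hx
      rw [e]
      exact h
    · convert M.zero_mem using 1
      ext k <;> rcases k with e | i | i <;> simp [bdryValue, bdryDeriv]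
  add_mem' := by
    rintro p q ⟨f, f', hf⟩ ⟨g, g', hg⟩
    refine ⟨f + g, f' + g', fun j => ?_, fun j => ⟨?_, ?_, ?_, ?_⟩, ?_⟩
    · filter_upwards [Lp.coeFn_add (p.1 j) (q.1 j), hf.rep j, hg.rep j] with x h h1 h2
      refine h.trans ?_
      simp [h1, h2]
    · intro x hx y hy
      exact ((hf.derivs j).ac x hx y hy).add ((hg.derivs j).ac x hx y hy)
    · intro x hx
      exact ((hf.derivs j).deriv x hx).add ((hg.derivs j).deriv x hx)
    · intro x hx y hy
      exact ((hf.derivs j).ac_deriv x hx y hy).add ((hg.derivs j).ac_deriv x hx y hy)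
    · filter_upwards [Lp.coeFn_add (p.2 j) (q.2 j), (hf.derivs j).deriv_deriv,
        (hg.derivs j).deriv_deriv] with x h h1 h2
      have e : ((p + q).2 j : ℝ → ℂ) x = p.2 j x + q.2 j x := h
      rw [e]
      exact h1.add h2
    · convert M.add_mem hf.bdry hg.bdry using 1
      ext k <;> rcases k with e | i | i <;> simp [bdryValue, bdryDeriv, add_comm]
  smul_mem' := by
    rintro c p ⟨f, f', hf⟩
    refine ⟨c • f, c • f', fun j => ?_, fun j => ⟨?_, ?_, ?_, ?_⟩, ?_⟩
    · filter_upwards [Lp.coeFn_smul c (p.1 j), hf.rep j] with x h h1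
      refine h.trans ?_
      simp [h1]
    · intro x hx y hy
      exact ((hf.derivs j).ac x hx y hy).const_smul c
    · intro x hx
      exact ((hf.derivs j).deriv x hx).const_smul c
    · intro x hx y hy
      exact ((hf.derivs j).ac_deriv x hx y hy).const_smul c
    · filter_upwards [Lp.coeFn_smul c (p.2 j), (hf.derivs j).deriv_deriv] with x h h1
      have e : ((c • p).2 j : ℝ → ℂ) x = c • p.2 j x := h
      rw [e]
      exact h1.const_smul c
    · convert M.smul_mem c hf.bdry using 1
      ext k <;> rcases k with e | i | i <;> simp [bdryValue, bdryDeriv]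

/-- The second derivative of an element of the domain is determined by that element. -/
theorem laplacianGraph_functional (M : Submodule ℂ (BdrySpace E I × BdrySpace E I))
    (p : G.L2Space × G.L2Space) (hp : p ∈ G.laplacianGraph M) (h0 : p.1 = 0) : p.2 = 0 := by
  obtain ⟨f, f', hf⟩ := hp
  refine PiLp.ext fun j => ?_
  have hs := G.interval_subset_closure_interior j
  have hd := hf.derivs j
  have hmeas : MeasurableSet (G.interval j) := by
    rcases j with e | i
    · exact measurableSet_Ici
    · exact measurableSet_Icc
  have huniq : UniqueDiffOn ℝ (G.interval j) := by
    rcases j with e | i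
    · exact uniqueDiffOn_Ici 0
    · exact uniqueDiffOn_Icc (G.len_pos i)
  have hf0 : EqOn (f j) 0 (G.interval j) := by
    refine Measure.eqOn_of_ae_eq (μ := volume) ?_
      (fun x hx => (hd.deriv x hx).continuousWithinAt) continuousOn_const hs
    have hz : (p.1 j : ℝ → ℂ) =ᵐ[volume.restrict (G.interval j)] 0 := by
      rw [h0]
      exact Lp.coeFn_zero _ _ _
    exact (hf.rep j).symm.trans hz
  have hf1 : ∀ x ∈ G.interval j, f' j x = 0 := fun x hx =>
    (huniq x hx).eq_deriv _ (hd.deriv x hx)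
      ((hasDerivWithinAt_const x _ (0 : ℂ)).congr (fun y hy => hf0 hy) (hf0 hx))
  refine (Lp.eq_zero_iff_ae_eq_zero).2 ?_
  filter_upwards [hd.deriv_deriv, ae_restrict_mem hmeas] with x hx hxm
  exact (huniq x hxm).eq_deriv _ hx.hasDerivWithinAt
    ((hasDerivWithinAt_const x _ (0 : ℂ)).congr (fun y hy => hf1 y hy) (hf1 x hxm))

/-- The Laplace operator `Δ(M, a) : ψ ↦ ψ''` on the Hilbert space of the metric graph, with domain
the `ψ` whose boundary data lie in `M`. -/
noncomputable def laplacian (M : Submodule ℂ (BdrySpace E I × BdrySpace E I)) :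
    G.L2Space →ₗ.[ℂ] G.L2Space :=
  (G.laplacianGraph M).toLinearPMap

/-- The Laplace operator has the intended graph. -/
theorem laplacian_graph (M : Submodule ℂ (BdrySpace E I × BdrySpace E I)) :
    (G.laplacian M).graph = G.laplacianGraph M :=
  Submodule.toLinearPMap_graph_eq _ (G.laplacianGraph_functional M)

end MetricGraph

/-! ### Inertia of Hermitian maps in finite dimension. -/

section FiniteDimensional

/-! Both halves compare the eigenfunctions with the Hermitian form ⟨u, v⟩ on `M`. The
parametrization w ↦ (-B†w, A†w) of `M` turns this form into -⟨w, AB†w⟩, so n₊ is the largest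
dimension of a subspace of `M` on which the form is negative definite
(`finrank_le_numPosEigenvalues`, `exists_finrank_eq_numPosEigenvalues`).

Upper bound: an eigenfunction for -κ² is a combination of e^{κx} and e^{-κx} on each edge, without
the growing term on external edges, so the eigenspace is the space of coefficients whose boundary
data lie in `M`. Integration by parts gives ⟨u, v⟩ = -(⟨ψ', φ'⟩ + l²⟨ψ, φ⟩), where u comes from ψ
and v from an eigenfunction φ for -l². Isotropy makes eigenfunctions for distinct κ orthogonal, so a
finite sum of boundary data has form value -(‖Σψ'‖² + Σκ²‖ψ‖²) < 0. The direct sum of all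
eigenspaces therefore embeds in `M` as a negative definite subspace (`sum_rank_comap_bdryData_le`).

Equality without internal edges: the boundary data of ce^{-κx} are (c, -κc). On the projection U of
`M` to the first factor there is a symmetric L whose graph lies in `M`, with ⟨u, v⟩ = ⟨u, Lu⟩ on
`M`. A negative definite subspace of dimension n₊ injects into U, so L has at least n₊ negative
eigenvalues -κ, and each eigenvector gives an eigenfunction for -κ²
(`IsMaximalIsotropic.finrank_le_sum_rank`). -/

theorem LinearMap.finrank_le_card_pos_of_re_inner_pos {F ι : Type*} [NormedAddCommGroup F]
    [InnerProductSpace ℂ F] [Fintype ι] (b : OrthonormalBasis ι ℂ F) (T : F →ₗ[ℂ] F) (lam : ι → ℝ)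
    (hT : ∀ i, T (b i) = (lam i : ℂ) • b i) (W : Submodule ℂ F)
    (hW : ∀ x ∈ W, x ≠ 0 → 0 < (inner ℂ x (T x)).re) :
    Module.finrank ℂ W ≤ Fintype.card {i // 0 < lam i} := by
  have : FiniteDimensional ℂ F := b.toBasis.finiteDimensional_of_finite
  -- Coordinates along the eigenvectors with positive eigenvalue. Where they all vanish the form is
  -- nonpositive, so `P` is injective on `W`.
  let P : F →ₗ[ℂ] ({i // 0 < lam i} → ℂ) := LinearMap.pi fun i => (innerSL ℂ (b i)).toLinearMap
  have hP : Function.Injective (P.domRestrict W) := by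
    rw [injective_iff_map_eq_zero]
    rintro ⟨x, hx⟩ h
    by_contra hne
    have hpos := hW x hx fun h0 => hne (Subtype.ext h0)
    have hx0 : ∀ i, 0 < lam i → inner ℂ (b i) x = 0 := fun i hi => congrFun h ⟨i, hi⟩
    have hexp : inner ℂ x (T x) = ∑ i, ((lam i * ‖inner ℂ (b i) x‖ ^ 2 : ℝ) : ℂ) := by
      conv_lhs => rw [← b.sum_repr x]
      rw [map_sum]
      simp only [map_smul, hT, smul_smul]
      rw [b.orthonormal.inner_sum]
      refine Finset.sum_congr rfl fun i _ => ?_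
      rw [b.repr_apply_apply, mul_comm (inner ℂ (b i) x), mul_left_comm, Complex.conj_mul']
      push_cast
      ring
    rw [hexp, ← Complex.ofReal_sum, Complex.ofReal_re] at hpos
    refine absurd hpos (not_lt.2 (Finset.sum_nonpos fun i _ => ?_))
    rcases lt_or_ge 0 (lam i) with hi | hi
    · simp [hx0 i hi]
    · exact mul_nonpos_of_nonpos_of_nonneg hi (by positivity)
  have := LinearMap.finrank_le_finrank_of_injective hP
  rwa [Module.finrank_fintype_fun_eq_card] at this

theorem Orthonormal.re_inner_pos_of_mem_span {F ι : Type*} [NormedAddCommGroup F]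
    [InnerProductSpace ℂ F] [Fintype ι] {v : ι → F} (hon : Orthonormal ℂ v) (T : F →ₗ[ℂ] F)
    {lam : ι → ℝ} (hv : ∀ i, T (v i) = (lam i : ℂ) • v i) (hpos : ∀ i, 0 < lam i) {x : F}
    (hx : x ∈ Submodule.span ℂ (range v)) (hne : x ≠ 0) : 0 < (inner ℂ x (T x)).re := by
  obtain ⟨c, rfl⟩ := (Submodule.mem_span_range_iff_exists_fun ℂ).1 hx
  have hexp : inner ℂ (∑ i, c i • v i) (T (∑ i, c i • v i)) =
      ∑ i, ((lam i * ‖c i‖ ^ 2 : ℝ) : ℂ) := by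
    rw [map_sum]
    simp only [map_smul, hv, smul_smul]
    rw [hon.inner_sum]
    refine Finset.sum_congr rfl fun i _ => ?_
    rw [← mul_assoc, Complex.conj_mul']
    push_cast
    ring
  rw [hexp, ← Complex.ofReal_sum, Complex.ofReal_re]
  obtain ⟨i, hi⟩ : ∃ i, c i ≠ 0 := by
    by_contra! h
    exact hne (by simp [h])
  refine Finset.sum_pos' (fun j _ => mul_nonneg (hpos j).le (by positivity))
    ⟨i, Finset.mem_univ i, ?_⟩
  exact mul_pos (hpos i) (by positivity)

theorem LinearMap.exists_finrank_eq_card_pos_re_inner_pos {F ι : Type*} [NormedAddCommGroup F]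
    [InnerProductSpace ℂ F] [Fintype ι] (b : OrthonormalBasis ι ℂ F) (T : F →ₗ[ℂ] F) (lam : ι → ℝ)
    (hT : ∀ i, T (b i) = (lam i : ℂ) • b i) :
    ∃ W : Submodule ℂ F, Module.finrank ℂ W = Fintype.card {i // 0 < lam i} ∧
      ∀ x ∈ W, x ≠ 0 → 0 < (inner ℂ x (T x)).re := by
  have hon : Orthonormal ℂ fun i : {i // 0 < lam i} => b i :=
    b.orthonormal.comp _ Subtype.val_injective
  have hW : ∀ x ∈ Submodule.span ℂ (Set.range fun i : {i // 0 < lam i} => b i), x ≠ 0 →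
      0 < (inner ℂ x (T x)).re :=
    fun x hx hne => hon.re_inner_pos_of_mem_span T (fun i => hT i.1) (fun i => i.2) hx hne
  exact ⟨_, finrank_span_eq_card hon.linearIndependent, hW⟩

theorem numPosEigenvalues_eq_card {n : Type*} [Fintype n] [DecidableEq n] {T : Matrix n n ℂ}
    (hT : T.IsHermitian) : numPosEigenvalues T = Fintype.card {i // 0 < hT.eigenvalues i} := by
  classical
  rw [numPosEigenvalues, hT.roots_charpoly_eq_eigenvalues, Multiset.filter_map, Multiset.card_map,
    Fintype.card_subtype, Finset.card_def, Finset.filter_val]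
  congr 1
  refine Multiset.filter_congr fun i _ => ?_
  simp

end FiniteDimensional

/-! ### Maximal isotropic subspaces via the Cayley transform. -/

section Symplectic

variable {E I : Type*} [Fintype E] [Fintype I]

theorem symplecticForm_eq (p q : BdrySpace E I × BdrySpace E I) :
    symplecticForm p q = star p.1 ⬝ᵥ q.2 - star p.2 ⬝ᵥ q.1 := by
  rw [symplecticForm, dotProduct_neg, sub_eq_add_neg]

/-- In the coordinates v ± iu the symplectic form is a difference of two scalar products, so
isotropy means that the two components have equal scalar products. -/
theorem symplecticForm_eq_cayley (p q : BdrySpace E I × BdrySpace E I) :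
    2 * Complex.I * symplecticForm p q =
      star (p.2 - Complex.I • p.1) ⬝ᵥ (q.2 - Complex.I • q.1) -
      star (p.2 + Complex.I • p.1) ⬝ᵥ (q.2 + Complex.I • q.1) := by
  rw [symplecticForm_eq]
  simp only [star_sub, star_add, star_smul, sub_dotProduct, add_dotProduct, dotProduct_sub,
    dotProduct_add, smul_dotProduct, dotProduct_smul, smul_eq_mul, Complex.star_def, Complex.conj_I]
  ring

theorem star_symplecticForm (p q : BdrySpace E I × BdrySpace E I) :
    star (symplecticForm p q) = -symplecticForm q p := by
  rw [symplecticForm_eq, symplecticForm_eq, star_sub, ← star_dotProduct, ← star_dotProduct]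
  ring

/-- The two components of the Cayley transform, `(u, v) ↦ v ± i u`. -/
def cayleyMap (s : ℂ) : BdrySpace E I × BdrySpace E I →ₗ[ℂ] BdrySpace E I :=
  LinearMap.snd ℂ _ _ + s • LinearMap.fst ℂ _ _

theorem symplecticForm_add_left (p p' q : BdrySpace E I × BdrySpace E I) :
    symplecticForm (p + p') q = symplecticForm p q + symplecticForm p' q := by
  simp only [symplecticForm_eq, Prod.fst_add, Prod.snd_add, star_add, add_dotProduct]
  ring

theorem symplecticForm_add_right (p q q' : BdrySpace E I × BdrySpace E I) :
    symplecticForm p (q + q') = symplecticForm p q + symplecticForm p q' := by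
  simp only [symplecticForm_eq, Prod.fst_add, Prod.snd_add, dotProduct_add]
  ring

theorem symplecticForm_smul_left (s : ℂ) (p q : BdrySpace E I × BdrySpace E I) :
    symplecticForm (s • p) q = star s * symplecticForm p q := by
  simp only [symplecticForm_eq, Prod.smul_fst, Prod.smul_snd, star_smul, smul_dotProduct,
    smul_eq_mul]
  ring

theorem symplecticForm_smul_right (s : ℂ) (p q : BdrySpace E I × BdrySpace E I) :
    symplecticForm p (s • q) = s * symplecticForm p q := by
  simp only [symplecticForm_eq, Prod.smul_fst, Prod.smul_snd, dotProduct_smul, smul_eq_mul]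
  ring

/-- Adjoining `p` keeps the subspace isotropic, so maximality absorbs `p`. The condition `hpp` is
removed in `IsMaximalIsotropic.mem_of_forall_symplecticForm`. -/
theorem IsMaximalIsotropic.mem_of_forall {M : Submodule ℂ (BdrySpace E I × BdrySpace E I)}
    (hM : IsMaximalIsotropic M) {p : BdrySpace E I × BdrySpace E I}
    (hp : ∀ q ∈ M, symplecticForm p q = 0) (hpp : symplecticForm p p = 0) : p ∈ M := by
  have hp' : ∀ q ∈ M, symplecticForm q p = 0 := fun q hq => by
    rw [← star_eq_zero, star_symplecticForm, hp q hq, neg_zero]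
  have hiso : IsIsotropic (M ⊔ Submodule.span ℂ {p}) := by
    intro x hx y hy
    obtain ⟨m, hm, a, ha, rfl⟩ := Submodule.mem_sup.1 hx
    obtain ⟨m', hm', a', ha', rfl⟩ := Submodule.mem_sup.1 hy
    obtain ⟨r, rfl⟩ := Submodule.mem_span_singleton.1 ha
    obtain ⟨r', rfl⟩ := Submodule.mem_span_singleton.1 ha'
    simp [symplecticForm_add_left, symplecticForm_add_right, symplecticForm_smul_left,
      symplecticForm_smul_right, hM.prop m hm m' hm', hp m' hm', hp' m hm, hpp]
  exact hM.le_of_ge hiso le_sup_left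
    (Submodule.mem_sup_right (Submodule.mem_span_singleton_self p))

open scoped ComplexOrder in
theorem exists_star_dotProduct_eq_zero {n : Type*} [Fintype n] {W : Submodule ℂ (n → ℂ)}
    (hW : W ≠ ⊤) : ∃ x : n → ℂ, star x ⬝ᵥ x = 1 ∧ ∀ w ∈ W, star x ⬝ᵥ w = 0 := by
  classical
  obtain ⟨f, hf, hfW⟩ := W.exists_le_ker_of_lt_top hW.lt_top
  obtain ⟨x, hx⟩ : ∃ x : n → ℂ, ∀ w, f w = star x ⬝ᵥ w := by
    refine ⟨fun i => star (f (Pi.single i 1)), fun w => ?_⟩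
    conv_lhs => rw [← Finset.univ_sum_single w, map_sum]
    refine Finset.sum_congr rfl fun i _ => ?_
    rw [Pi.star_apply, star_star, mul_comm, ← smul_eq_mul, ← map_smul, ← Pi.single_smul, smul_eq_mul,
      mul_one]
  have hx0 : x ≠ 0 := by
    rintro rfl
    exact hf (LinearMap.ext fun w => by simp [hx])
  have hpos : 0 < star x ⬝ᵥ x := dotProduct_star_self_pos_iff.2 hx0
  obtain ⟨r, hr, hrx⟩ : ∃ r : ℝ, 0 < r ∧ star x ⬝ᵥ x = r := by
    obtain ⟨h1, h2⟩ := Complex.pos_iff.1 hpos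
    exact ⟨_, h1, Complex.ext rfl (by simp [← h2])⟩
  refine ⟨(((Real.sqrt r)⁻¹ : ℝ) : ℂ) • x, ?_, fun w hw => ?_⟩
  · rw [star_smul, smul_dotProduct, dotProduct_smul, hrx, Complex.star_def, Complex.conj_ofReal,
      smul_eq_mul, smul_eq_mul, ← Complex.ofReal_mul, ← Complex.ofReal_mul, ← mul_assoc, ← mul_inv,
      Real.mul_self_sqrt hr.le, inv_mul_cancel₀ hr.ne', Complex.ofReal_one]
  · rw [star_smul, smul_dotProduct, ← hx, LinearMap.mem_ker.1 (hfW hw), smul_zero]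

open scoped ComplexOrder in
theorem star_dotProduct_self_eq_zero {n : Type*} [Fintype n] {x : n → ℂ} :
    star x ⬝ᵥ x = 0 ↔ x = 0 :=
  dotProduct_star_self_eq_zero

theorem IsIsotropic.star_cayleyMap {M : Submodule ℂ (BdrySpace E I × BdrySpace E I)}
    (hM : IsIsotropic M) {p : BdrySpace E I × BdrySpace E I} (hp : p ∈ M) :
    star (cayleyMap (-Complex.I) p) ⬝ᵥ cayleyMap (-Complex.I) p =
      star (cayleyMap Complex.I p) ⬝ᵥ cayleyMap Complex.I p := by
  have h := symplecticForm_eq_cayley p p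
  rw [hM p hp p hp, mul_zero] at h
  simpa [cayleyMap, sub_eq_add_neg] using (sub_eq_zero.1 h.symm)

omit [Fintype E] [Fintype I] in
theorem eq_zero_of_cayleyMap_eq_zero {p : BdrySpace E I × BdrySpace E I}
    (h1 : cayleyMap Complex.I p = 0) (h2 : cayleyMap (-Complex.I) p = 0) : p = 0 := by
  simp only [cayleyMap, LinearMap.add_apply, LinearMap.smul_apply, LinearMap.snd_apply,
    LinearMap.fst_apply, neg_smul] at h1 h2
  have hv : p.2 = 0 := by
    have h3 : (2 : ℂ) • p.2 = 0 := by
      rw [two_smul]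
      linear_combination (exp := 1) h1 + h2
    simpa using h3
  refine Prod.ext ?_ hv
  simpa [hv] using h1

theorem IsIsotropic.injective_cayleyMap {M : Submodule ℂ (BdrySpace E I × BdrySpace E I)}
    (hM : IsIsotropic M) {s : ℂ} (hs : s = Complex.I ∨ s = -Complex.I) :
    Function.Injective ((cayleyMap s).domRestrict M) := by
  rw [injective_iff_map_eq_zero]
  rintro ⟨p, hp⟩ h
  have h' : cayleyMap s p = 0 := h
  have e := hM.star_cayleyMap hp
  refine Subtype.ext ?_
  rcases hs with rfl | rfl
  · rw [h', dotProduct_zero, star_dotProduct_self_eq_zero] at e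
    exact eq_zero_of_cayleyMap_eq_zero h' e
  · rw [h', dotProduct_zero, eq_comm, star_dotProduct_self_eq_zero] at e
    exact eq_zero_of_cayleyMap_eq_zero e h'

theorem IsIsotropic.finrank_map_cayleyMap {M : Submodule ℂ (BdrySpace E I × BdrySpace E I)}
    (hM : IsIsotropic M) {s : ℂ} (hs : s = Complex.I ∨ s = -Complex.I) :
    Module.finrank ℂ (M.map (cayleyMap s)) = Module.finrank ℂ M := by
  rw [← LinearMap.range_domRestrict]
  exact LinearMap.finrank_range_of_inj (hM.injective_cayleyMap hs)

/-- Both images have the dimension of `M`, so if one is proper, both are. Unit vectors x, y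
orthogonal to them are the Cayley components of a vector that is isotropic (equal norms) and
ω-orthogonal to `M`. It lies in `M` by maximality, yet x is orthogonal to the image. -/
theorem IsMaximalIsotropic.map_cayleyMap_eq_top
    {M : Submodule ℂ (BdrySpace E I × BdrySpace E I)} (hM : IsMaximalIsotropic M) {s : ℂ}
    (hs : s = Complex.I ∨ s = -Complex.I) : M.map (cayleyMap s) = ⊤ := by
  by_contra hne
  have hall : ∀ t : ℂ, t = Complex.I ∨ t = -Complex.I → M.map (cayleyMap t) ≠ ⊤ := by
    intro t ht htop
    refine hne (Submodule.eq_top_of_finrank_eq ?_)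
    rw [hM.prop.finrank_map_cayleyMap hs, ← hM.prop.finrank_map_cayleyMap ht, htop, finrank_top]
  obtain ⟨x, hx1, hx⟩ := exists_star_dotProduct_eq_zero (hall _ (Or.inl rfl))
  obtain ⟨y, hy1, hy⟩ := exists_star_dotProduct_eq_zero (hall _ (Or.inr rfl))
  -- The solution of v + iu = x, v - iu = y.
  let p : BdrySpace E I × BdrySpace E I :=
    ((-Complex.I / 2) • (x - y), (1 / 2 : ℂ) • (x + y))
  have hpx : p.2 + Complex.I • p.1 = x := by
    ext k
    simp only [p, Pi.add_apply, Pi.smul_apply, Pi.sub_apply, smul_eq_mul]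
    linear_combination (-(x k - y k) / 2) * Complex.I_sq
  have hpy : p.2 - Complex.I • p.1 = y := by
    ext k
    simp only [p, Pi.add_apply, Pi.smul_apply, Pi.sub_apply, smul_eq_mul]
    linear_combination ((x k - y k) / 2) * Complex.I_sq
  have h2I : (2 * Complex.I) ≠ 0 := by simp
  have hp : p ∈ M := by
    refine hM.mem_of_forall (fun q hq => ?_) ?_
    · have h := symplecticForm_eq_cayley p q
      rw [hpx, hpy] at h
      have e1 := hx _ (Submodule.mem_map_of_mem hq)
      have e2 := hy _ (Submodule.mem_map_of_mem hq)
      simp only [cayleyMap, LinearMap.add_apply, LinearMap.smul_apply, LinearMap.snd_apply,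
        LinearMap.fst_apply, neg_smul, ← sub_eq_add_neg] at e1 e2
      rw [e1, e2, sub_zero] at h
      exact (mul_eq_zero.1 h).resolve_left h2I
    · have h := symplecticForm_eq_cayley p p
      rw [hpx, hpy, hx1, hy1, sub_self] at h
      exact (mul_eq_zero.1 h).resolve_left h2I
  have := hx _ (Submodule.mem_map_of_mem hp)
  rw [show cayleyMap Complex.I p = x from hpx, hx1] at this
  exact one_ne_zero this

theorem IsMaximalIsotropic.finrank_eq {M : Submodule ℂ (BdrySpace E I × BdrySpace E I)}
    (hM : IsMaximalIsotropic M) : Module.finrank ℂ M = Fintype.card (BdryIdx E I) := by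
  rw [← hM.prop.finrank_map_cayleyMap (Or.inl rfl), hM.map_cayleyMap_eq_top (Or.inl rfl),
    finrank_top, Module.finrank_fintype_fun_eq_card]

/-- Subtract an element `m` of `M` with the same v + iu, then pair with an element `q` of `M` having
the same v - iu as the difference: the form reduces to the squared norm of that component, which
must vanish. -/
theorem IsMaximalIsotropic.mem_of_forall_symplecticForm
    {M : Submodule ℂ (BdrySpace E I × BdrySpace E I)} (hM : IsMaximalIsotropic M)
    {p : BdrySpace E I × BdrySpace E I} (hp : ∀ q ∈ M, symplecticForm p q = 0) : p ∈ M := by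
  obtain ⟨m, hm, hmp⟩ : cayleyMap Complex.I p ∈ M.map (cayleyMap Complex.I) := by
    rw [hM.map_cayleyMap_eq_top (Or.inl rfl)]
    trivial
  have h1 : cayleyMap Complex.I (p - m) = 0 := by rw [map_sub, hmp, sub_self]
  obtain ⟨q, hq, hqp⟩ : cayleyMap (-Complex.I) (p - m) ∈ M.map (cayleyMap (-Complex.I)) := by
    rw [hM.map_cayleyMap_eq_top (Or.inr rfl)]
    trivial
  have h2 : symplecticForm (p - m) q = 0 := by
    rw [sub_eq_add_neg, symplecticForm_add_left, hp q hq, ← neg_one_smul ℂ m,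
      symplecticForm_smul_left, hM.prop m hm q hq, mul_zero, add_zero]
  have h3 := symplecticForm_eq_cayley (p - m) q
  rw [h2, mul_zero, show (p - m).2 + Complex.I • (p - m).1 = 0 from h1, star_zero,
    zero_dotProduct, sub_zero] at h3
  have h4 : star (cayleyMap (-Complex.I) (p - m)) ⬝ᵥ cayleyMap (-Complex.I) (p - m) = 0 := by
    conv_lhs => enter [2]; rw [← hqp]
    rw [cayleyMap, LinearMap.add_apply, LinearMap.add_apply, LinearMap.smul_apply,
      LinearMap.smul_apply, neg_smul, neg_smul, ← sub_eq_add_neg, ← sub_eq_add_neg]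
    exact h3.symm
  have h5 := eq_zero_of_cayleyMap_eq_zero h1 (star_dotProduct_self_eq_zero.1 h4)
  rwa [sub_eq_zero.1 h5]

/-- The parametrization `w ↦ (-B† w, A† w)` of `ℳ(A, B)`. -/
def adjointParam (A B : Matrix (BdryIdx E I) (BdryIdx E I) ℂ) :
    BdrySpace E I →ₗ[ℂ] BdrySpace E I × BdrySpace E I :=
  (-(Bᴴ).mulVecLin).prod (Aᴴ).mulVecLin

theorem star_conjTranspose_mulVec_dotProduct {n : Type*} [Fintype n] (A : Matrix n n ℂ)
    (w u : n → ℂ) : star (Aᴴ *ᵥ w) ⬝ᵥ u = star w ⬝ᵥ (A *ᵥ u) := by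
  rw [star_mulVec, conjTranspose_conjTranspose, dotProduct_mulVec]

theorem adjointParam_apply (A B : Matrix (BdryIdx E I) (BdryIdx E I) ℂ) (w : BdrySpace E I) :
    adjointParam A B w = (-(Bᴴ *ᵥ w), Aᴴ *ᵥ w) := rfl

theorem mem_boundarySubspace {A B : Matrix (BdryIdx E I) (BdryIdx E I) ℂ}
    {p : BdrySpace E I × BdrySpace E I} :
    p ∈ boundarySubspace A B ↔ A *ᵥ p.1 + B *ᵥ p.2 = 0 := by
  simp [boundarySubspace]

theorem adjointParam_mem {A B : Matrix (BdryIdx E I) (BdryIdx E I) ℂ}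
    (hM : IsMaximalIsotropic (boundarySubspace A B)) (w : BdrySpace E I) :
    adjointParam A B w ∈ boundarySubspace A B := by
  refine hM.mem_of_forall_symplecticForm fun q hq => ?_
  have h : symplecticForm (adjointParam A B w) q = -(star w ⬝ᵥ (A *ᵥ q.1 + B *ᵥ q.2)) := by
    simp only [symplecticForm_eq, adjointParam_apply, star_neg, neg_dotProduct,
      star_conjTranspose_mulVec_dotProduct,
      dotProduct_add]
    ring
  rw [h, mem_boundarySubspace.1 hq, dotProduct_zero, neg_zero]

/-- That (-B†w, A†w) satisfies the equation of `M` says BA†w = AB†w. -/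
theorem mul_conjTranspose_isHermitian {A B : Matrix (BdryIdx E I) (BdryIdx E I) ℂ}
    (hM : IsMaximalIsotropic (boundarySubspace A B)) : (A * Bᴴ).IsHermitian := by
  classical
  rw [IsHermitian, conjTranspose_mul, conjTranspose_conjTranspose]
  refine Matrix.ext_iff_mulVec.2 fun w => ?_
  have h := mem_boundarySubspace.1 (adjointParam_mem hM w)
  simp only [adjointParam_apply, mulVec_neg, mulVec_mulVec] at h
  linear_combination (exp := 1) h

/-- Since dim `M` is half of the total dimension, (u, v) ↦ Au + Bv is onto; a vector killed by both
A† and B† is orthogonal to its range. -/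
theorem adjointParam_injective {A B : Matrix (BdryIdx E I) (BdryIdx E I) ℂ}
    (hM : IsMaximalIsotropic (boundarySubspace A B)) :
    Function.Injective (adjointParam A B) := by
  have hsurj : LinearMap.range (A.mulVecLin.coprod B.mulVecLin) = ⊤ := by
    refine Submodule.eq_top_of_finrank_eq ?_
    have h1 := LinearMap.finrank_range_add_finrank_ker (A.mulVecLin.coprod B.mulVecLin)
    have h2 := hM.finrank_eq
    rw [boundarySubspace] at h2
    rw [h2, Module.finrank_prod, Module.finrank_fintype_fun_eq_card] at h1
    rw [Module.finrank_fintype_fun_eq_card]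
    omega
  rw [injective_iff_map_eq_zero]
  intro w hw
  obtain ⟨p, hp⟩ := LinearMap.range_eq_top.1 hsurj w
  have hB : Bᴴ *ᵥ w = 0 := by simpa [adjointParam_apply] using congrArg Prod.fst hw
  have hA : Aᴴ *ᵥ w = 0 := by simpa [adjointParam_apply] using congrArg Prod.snd hw
  rw [← star_dotProduct_self_eq_zero]
  conv_lhs => enter [2]; rw [← hp]
  simp only [LinearMap.coprod_apply, mulVecLin_apply, dotProduct_add,
    ← star_conjTranspose_mulVec_dotProduct, hA, hB, star_zero, zero_dotProduct, add_zero]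

theorem range_adjointParam {A B : Matrix (BdryIdx E I) (BdryIdx E I) ℂ}
    (hM : IsMaximalIsotropic (boundarySubspace A B)) :
    LinearMap.range (adjointParam A B) = boundarySubspace A B := by
  refine Submodule.eq_of_le_of_finrank_eq ?_ ?_
  · rintro _ ⟨w, rfl⟩
    exact adjointParam_mem hM w
  · rw [LinearMap.finrank_range_of_inj (adjointParam_injective hM), hM.finrank_eq,
      Module.finrank_fintype_fun_eq_card]

theorem star_adjointParam_dotProduct {A B : Matrix (BdryIdx E I) (BdryIdx E I) ℂ}
    (hM : IsMaximalIsotropic (boundarySubspace A B)) (w : BdrySpace E I) :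
    star (adjointParam A B w).1 ⬝ᵥ (adjointParam A B w).2 =
      -(star w ⬝ᵥ ((A * Bᴴ) *ᵥ w)) := by
  rw [← (mul_conjTranspose_isHermitian hM).eq, conjTranspose_mul, conjTranspose_conjTranspose,
    ← mulVec_mulVec, ← star_conjTranspose_mulVec_dotProduct]
  simp [adjointParam_apply]

/-! ### Negative subspaces of `M` measured by AB†. -/

variable [DecidableEq E] [DecidableEq I]

theorem finrank_le_numPosEigenvalues {A B : Matrix (BdryIdx E I) (BdryIdx E I) ℂ}
    (hM : IsMaximalIsotropic (boundarySubspace A B))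
    {W : Submodule ℂ (BdrySpace E I × BdrySpace E I)} (hWM : W ≤ boundarySubspace A B)
    (hW : ∀ p ∈ W, p ≠ 0 → (star p.1 ⬝ᵥ p.2).re < 0) :
    Module.finrank ℂ W ≤ numPosEigenvalues (A * Bᴴ) := by
  have hH := mul_conjTranspose_isHermitian hM
  let e : EuclideanSpace ℂ (BdryIdx E I) →ₗ[ℂ] BdrySpace E I × BdrySpace E I :=
    adjointParam A B ∘ₗ (WithLp.linearEquiv 2 ℂ (BdryIdx E I → ℂ)).toLinearMap
  have he : Function.Injective e :=
    (adjointParam_injective hM).comp (WithLp.linearEquiv 2 ℂ (BdryIdx E I → ℂ)).injective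
  have hWr : W ≤ LinearMap.range e := by
    intro p hp
    obtain ⟨w, rfl⟩ := (range_adjointParam hM).ge (hWM hp)
    exact ⟨WithLp.toLp 2 w, rfl⟩
  have hfin : Module.finrank ℂ (W.comap e) = Module.finrank ℂ W := by
    rw [(Submodule.equivMapOfInjective e he _).finrank_eq, Submodule.map_comap_eq_of_le hWr]
  rw [numPosEigenvalues_eq_card hH, ← hfin]
  refine LinearMap.finrank_le_card_pos_of_re_inner_pos hH.eigenvectorBasis
    (Matrix.toEuclideanLin (A * Bᴴ)) hH.eigenvalues (fun i => ?_) _ fun x hx hne => ?_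
  · ext1 k
    have := congrFun (hH.mulVec_eigenvectorBasis i) k
    simpa using this
  · have h := hW (e x) hx (fun h0 => hne (he (h0.trans (map_zero e).symm)))
    have h2 : star (e x).1 ⬝ᵥ (e x).2 = _ := star_adjointParam_dotProduct hM x.ofLp
    rw [h2, Complex.neg_re, neg_lt_zero] at h
    rwa [EuclideanSpace.inner_eq_star_dotProduct, dotProduct_comm]

theorem exists_finrank_eq_numPosEigenvalues {A B : Matrix (BdryIdx E I) (BdryIdx E I) ℂ}
    (hM : IsMaximalIsotropic (boundarySubspace A B)) :
    ∃ W ≤ boundarySubspace A B, Module.finrank ℂ W = numPosEigenvalues (A * Bᴴ) ∧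
      ∀ p ∈ W, p ≠ 0 → (star p.1 ⬝ᵥ p.2).re < 0 := by
  have hH := mul_conjTranspose_isHermitian hM
  let e : EuclideanSpace ℂ (BdryIdx E I) →ₗ[ℂ] BdrySpace E I × BdrySpace E I :=
    adjointParam A B ∘ₗ (WithLp.linearEquiv 2 ℂ (BdryIdx E I → ℂ)).toLinearMap
  have he : Function.Injective e :=
    (adjointParam_injective hM).comp (WithLp.linearEquiv 2 ℂ (BdryIdx E I → ℂ)).injective
  obtain ⟨W, hfin, hW⟩ := LinearMap.exists_finrank_eq_card_pos_re_inner_pos hH.eigenvectorBasis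
    (Matrix.toEuclideanLin (A * Bᴴ)) hH.eigenvalues (fun i => by
      ext1 k
      have := congrFun (hH.mulVec_eigenvectorBasis i) k
      simpa using this)
  refine ⟨W.map e, ?_, ?_, ?_⟩
  · rintro _ ⟨x, _, rfl⟩
    exact adjointParam_mem hM x.ofLp
  · rw [← (Submodule.equivMapOfInjective e he W).finrank_eq, hfin, numPosEigenvalues_eq_card hH]
  · rintro _ ⟨x, hx, rfl⟩ hne
    have h := hW x hx (fun h0 => hne (by rw [h0, map_zero]))
    have h2 : star (e x).1 ⬝ᵥ (e x).2 = _ := star_adjointParam_dotProduct hM x.ofLp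
    rw [h2, Complex.neg_re, neg_lt_zero]
    rwa [EuclideanSpace.inner_eq_star_dotProduct, dotProduct_comm] at h

end Symplectic

/-! ### Exponential solutions on intervals. -/

/-- The solution `x ↦ a e^{κ x} + b e^{-κ x}` of `f'' = κ² f`. -/
noncomputable def expSol (κ : ℝ) (a b : ℂ) (x : ℝ) : ℂ :=
  a * Real.exp (κ * x) + b * Real.exp (-(κ * x))

theorem hasDerivAt_ofReal_exp_mul (κ x : ℝ) :
    HasDerivAt (fun x : ℝ => ((Real.exp (κ * x) : ℝ) : ℂ)) (κ * Real.exp (κ * x)) x := by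
  have h : HasDerivAt (fun x : ℝ => Real.exp (κ * x)) (Real.exp (κ * x) * (κ * 1)) x :=
    ((hasDerivAt_id x).const_mul κ).exp
  convert h.ofReal_comp using 1
  push_cast
  ring

theorem hasDerivAt_expSol (κ : ℝ) (a b : ℂ) (x : ℝ) :
    HasDerivAt (expSol κ a b) (expSol κ (κ * a) (-κ * b) x) x := by
  have h1 := (hasDerivAt_ofReal_exp_mul κ x).const_mul a
  have h2 := (hasDerivAt_ofReal_exp_mul (-κ) x).const_mul b
  simp only [neg_mul] at h2
  refine (h1.add h2).congr_deriv ?_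
  simp only [expSol]
  push_cast
  ring

theorem contDiff_expSol (κ : ℝ) (a b : ℂ) : ContDiff ℝ 1 (expSol κ a b) := by
  have h : ∀ s : ℝ, ContDiff ℝ 1 (fun x : ℝ => ((Real.exp (s * x) : ℝ) : ℂ)) := fun s =>
    Complex.ofRealCLM.contDiff.comp (contDiff_const.mul contDiff_id).exp
  have h2 := h (-κ)
  simp only [neg_mul] at h2
  exact (contDiff_const.mul (h κ)).add (contDiff_const.mul h2)

theorem continuous_expSol (κ : ℝ) (a b : ℂ) : Continuous (expSol κ a b) :=
  (contDiff_expSol κ a b).continuous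

theorem expSol_add (κ : ℝ) (a b a' b' : ℂ) (x : ℝ) :
    expSol κ (a + a') (b + b') x = expSol κ a b x + expSol κ a' b' x := by
  simp only [expSol]; ring

theorem expSol_smul (κ : ℝ) (r a b : ℂ) (x : ℝ) :
    expSol κ (r * a) (r * b) x = r * expSol κ a b x := by
  simp only [expSol]; ring

theorem tendsto_expSol_zero {κ : ℝ} (hκ : 0 < κ) (b : ℂ) :
    Filter.Tendsto (expSol κ 0 b) Filter.atTop (nhds 0) := by
  have h : Filter.Tendsto (fun x : ℝ => Real.exp (-(κ * x))) Filter.atTop (nhds 0) :=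
    Real.tendsto_exp_neg_atTop_nhds_zero.comp (Filter.tendsto_id.const_mul_atTop hκ)
  have h2 := (Complex.continuous_ofReal.tendsto 0).comp h
  have h3 := h2.const_mul b
  rw [Complex.ofReal_zero, mul_zero] at h3
  refine h3.congr fun x => ?_
  simp [expSol]

theorem memLp_expSol_Ici {κ : ℝ} (hκ : 0 < κ) (b : ℂ) :
    MemLp (expSol κ 0 b) 2 (volume.restrict (Ici 0)) := by
  rw [memLp_two_iff_integrable_sq_norm (continuous_expSol κ 0 b).aestronglyMeasurable]
  have h : IntegrableOn (fun x : ℝ => Real.exp (-(2 * κ) * x)) (Ioi 0) :=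
    integrableOn_exp_mul_Ioi (by linarith) 0
  rw [← integrableOn_Ici_iff_integrableOn_Ioi] at h
  refine (h.const_mul (‖b‖ ^ 2)).congr (Filter.Eventually.of_forall fun x => ?_)
  have e : Real.exp (-(2 * κ) * x) = Real.exp (-(κ * x)) ^ 2 := by
    rw [← Real.exp_nat_mul]; congr 1; push_cast; ring
  simp only [expSol, zero_mul, zero_add, norm_mul, Complex.norm_real, Real.norm_eq_abs,
    Real.abs_exp, mul_pow, e]

theorem memLp_expSol_Icc (κ : ℝ) (a b : ℂ) (l : ℝ) :
    MemLp (expSol κ a b) 2 (volume.restrict (Icc 0 l)) := by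
  rw [memLp_two_iff_integrable_sq_norm (continuous_expSol κ a b).aestronglyMeasurable]
  exact ((continuous_expSol κ a b).norm.pow 2).integrableOn_Icc

theorem hasDerivAt_conj_expSol_mul (κ l : ℝ) (a b a' b' : ℂ) (x : ℝ) :
    HasDerivAt (fun x => star (expSol κ a b x) * expSol l a' b' x)
      (star (expSol κ (κ * a) (-κ * b) x) * expSol l a' b' x +
        star (expSol κ a b x) * expSol l (l * a') (-l * b') x) x :=
  (hasDerivAt_expSol κ a b x).star.mul (hasDerivAt_expSol l a' b' x)

theorem integrable_star_mul {μ : Measure ℝ} {f g : ℝ → ℂ} (hf : MemLp f 2 μ) (hg : MemLp g 2 μ) :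
    Integrable (fun x => star (f x) * g x) μ :=
  hf.star.integrable_mul hg

theorem setIntegral_Icc_deriv_star_mul (κ l : ℝ) (a b a' b' : ℂ) {s : ℝ} (hs : 0 ≤ s) :
    (∫ x in Icc 0 s, star (expSol κ (κ * a) (-κ * b) x) * expSol l a' b' x) +
      ∫ x in Icc 0 s, star (expSol κ a b x) * expSol l (l * a') (-l * b') x =
    star (expSol κ a b s) * expSol l a' b' s - star (expSol κ a b 0) * expSol l a' b' 0 := by
  have i1 := integrable_star_mul (memLp_expSol_Icc κ (κ * a) (-κ * b) s)
    (memLp_expSol_Icc l a' b' s)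
  have i2 := integrable_star_mul (memLp_expSol_Icc κ a b s)
    (memLp_expSol_Icc l (l * a') (-l * b') s)
  rw [← integral_add i1 i2, integral_Icc_eq_integral_Ioc, ← intervalIntegral.integral_of_le hs]
  refine intervalIntegral.integral_eq_sub_of_hasDerivAt
    (fun x _ => hasDerivAt_conj_expSol_mul κ l a b a' b' x) ?_
  rw [intervalIntegrable_iff_integrableOn_Icc_of_le hs]
  exact i1.add i2

theorem setIntegral_Ici_deriv_star_mul {κ l : ℝ} (hκ : 0 < κ) (hl : 0 < l) (b b' : ℂ) :
    (∫ x in Ici 0, star (expSol κ 0 (-κ * b) x) * expSol l 0 b' x) +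
      ∫ x in Ici 0, star (expSol κ 0 b x) * expSol l 0 (-l * b') x =
    - (star (expSol κ 0 b 0) * expSol l 0 b' 0) := by
  have i1 := integrable_star_mul (memLp_expSol_Ici hκ (-κ * b)) (memLp_expSol_Ici hl b')
  have i2 := integrable_star_mul (memLp_expSol_Ici hκ b) (memLp_expSol_Ici hl (-l * b'))
  rw [← integral_add i1 i2, integral_Ici_eq_integral_Ioi,
    ← zero_sub (star (expSol κ 0 b 0) * _)]
  refine integral_Ioi_of_hasDerivAt_of_tendsto'
    (f := fun x => star (expSol κ 0 b x) * expSol l 0 b' x) (fun x _ => ?_) ?_ ?_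
  · have h := hasDerivAt_conj_expSol_mul κ l 0 b 0 b' x
    rwa [mul_zero, mul_zero] at h
  · exact IntegrableOn.mono_set (i1.add i2) Ioi_subset_Ici_self
  · have h := (tendsto_expSol_zero hκ b).star.mul (tendsto_expSol_zero hl b')
    rwa [star_zero, zero_mul] at h

/-! ### Exponential solutions on the graph and their boundary data. -/

namespace MetricGraph

variable {V E I : Type*} (G : MetricGraph V E I)

/-- The coefficient of the growing exponential on an edge; it vanishes on external edges. -/
def growCoeff (c : BdrySpace E I) : E ⊕ I → ℂ
  | .inl _ => 0
  | .inr i => c (.inr (.inr i))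

/-- The coefficient of the decaying exponential on an edge. -/
def decayCoeff (c : BdrySpace E I) : E ⊕ I → ℂ
  | .inl e => c (.inl e)
  | .inr i => c (.inr (.inl i))

/-- The functions on the edges with given coefficients. -/
noncomputable def edgeSol (κ : ℝ) (c : BdrySpace E I) (j : E ⊕ I) : ℝ → ℂ :=
  expSol κ (growCoeff c j) (decayCoeff c j)

/-- The coefficients of the derivative. -/
def derivCoeff (κ : ℝ) : BdrySpace E I →ₗ[ℂ] BdrySpace E I where
  toFun c k := match k with
    | .inl e => -κ * c (.inl e)
    | .inr (.inl i) => -κ * c (.inr (.inl i))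
    | .inr (.inr i) => κ * c (.inr (.inr i))
  map_add' c d := by ext k; rcases k with e | i | i <;> simp <;> ring
  map_smul' r c := by ext k; rcases k with e | i | i <;> simp <;> ring

theorem derivCoeff_derivCoeff (κ : ℝ) (c : BdrySpace E I) :
    derivCoeff κ (derivCoeff κ c) = ((κ : ℂ) ^ 2) • c := by
  ext k; rcases k with e | i | i <;> simp [derivCoeff] <;> ring

theorem edgeSol_derivCoeff (κ : ℝ) (c : BdrySpace E I) (j : E ⊕ I) :
    edgeSol κ (derivCoeff κ c) j = expSol κ (κ * growCoeff c j) (-κ * decayCoeff c j) := by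
  rcases j with e | i <;> simp [edgeSol, growCoeff, decayCoeff, derivCoeff]

theorem edgeSol_add (κ : ℝ) (c d : BdrySpace E I) :
    edgeSol κ (c + d) = edgeSol κ c + edgeSol κ d := by
  ext j x
  rcases j with e | i <;>
    simp [edgeSol, growCoeff, decayCoeff, ← expSol_add]

theorem edgeSol_smul (κ : ℝ) (r : ℂ) (c : BdrySpace E I) :
    edgeSol κ (r • c) = r • edgeSol κ c := by
  ext j x
  rcases j with e | i <;>
    simp [edgeSol, growCoeff, decayCoeff, ← expSol_smul]

theorem hasDerivAt_edgeSol (κ : ℝ) (c : BdrySpace E I) (j : E ⊕ I) (x : ℝ) :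
    HasDerivAt (edgeSol κ c j) (edgeSol κ (derivCoeff κ c) j x) x := by
  rw [edgeSol_derivCoeff]
  exact hasDerivAt_expSol _ _ _ _

theorem memLp_edgeSol {κ : ℝ} (hκ : 0 < κ) (c : BdrySpace E I) (j : E ⊕ I) :
    MemLp (edgeSol κ c j) 2 (volume.restrict (G.interval j)) := by
  rcases j with e | i
  · exact memLp_expSol_Ici hκ _
  · exact memLp_expSol_Icc κ _ _ _

/-- The element of the Hilbert space with given coefficients. -/
noncomputable def solVec {κ : ℝ} (hκ : 0 < κ) : BdrySpace E I →ₗ[ℂ] G.L2Space where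
  toFun c := WithLp.toLp 2 fun j => (G.memLp_edgeSol hκ c j).toLp (edgeSol κ c j)
  map_add' c d := by
    ext1 j
    rw [PiLp.add_apply, ← MemLp.toLp_add]
    exact MemLp.toLp_congr (G.memLp_edgeSol hκ (c + d) j)
      ((G.memLp_edgeSol hκ c j).add (G.memLp_edgeSol hκ d j)) (by rw [edgeSol_add]; rfl)
  map_smul' r c := by
    ext1 j
    rw [PiLp.smul_apply, RingHom.id_apply, ← MemLp.toLp_const_smul]
    exact MemLp.toLp_congr (G.memLp_edgeSol hκ (r • c) j)
      ((G.memLp_edgeSol hκ c j).const_smul r) (by rw [edgeSol_smul]; rfl)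

theorem coeFn_solVec {κ : ℝ} (hκ : 0 < κ) (c : BdrySpace E I) (j : E ⊕ I) :
    G.solVec hκ c j =ᵐ[volume.restrict (G.interval j)] edgeSol κ c j :=
  (G.memLp_edgeSol hκ c j).coeFn_toLp

/-- The boundary data of the functions with given coefficients. -/
noncomputable def bdryData (κ : ℝ) : BdrySpace E I →ₗ[ℂ] BdrySpace E I × BdrySpace E I where
  toFun c := (G.bdryValue (edgeSol κ c), G.bdryDeriv (edgeSol κ (derivCoeff κ c)))
  map_add' c d := by
    rw [map_add, edgeSol_add, edgeSol_add]
    ext k <;> rcases k with e | i | i <;> simp [bdryValue, bdryDeriv, add_comm]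
  map_smul' r c := by
    rw [map_smul, edgeSol_smul, edgeSol_smul]
    ext k <;> rcases k with e | i | i <;> simp [bdryValue, bdryDeriv]

/-- Integration by parts on every edge; the inward sign of the derivative collects all endpoint
terms into one scalar product, and decay removes the one at infinity. The exponents may differ so
that different eigenvalues can be compared. -/
theorem star_bdryValue_dotProduct_bdryDeriv [Fintype E] [Fintype I] {κ l : ℝ} (hκ : 0 < κ)
    (hl : 0 < l) (c d : BdrySpace E I) :
    star (G.bdryValue (edgeSol κ c)) ⬝ᵥ G.bdryDeriv (edgeSol l d) =
      -(inner ℂ (G.solVec hκ (derivCoeff κ c)) (G.solVec hl d) +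
        inner ℂ (G.solVec hκ c) (G.solVec hl (derivCoeff l d))) := by
  have key : ∀ (c d : BdrySpace E I) (j : E ⊕ I),
      inner ℂ (G.solVec hκ c j) (G.solVec hl d j) =
        ∫ x in G.interval j, star (edgeSol κ c j x) * edgeSol l d j x := by
    intro c d j
    rw [L2.inner_def]
    refine integral_congr_ae ?_
    filter_upwards [G.coeFn_solVec hκ c j, G.coeFn_solVec hl d j] with x h1 h2
    rw [h1, h2, RCLike.inner_apply']
    rfl
  rw [PiLp.inner_apply, PiLp.inner_apply, ← Finset.sum_add_distrib]
  simp only [key]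
  rw [dotProduct, Fintype.sum_sum_type, Fintype.sum_sum_type, Fintype.sum_sum_type, neg_add,
    ← Finset.sum_neg_distrib, ← Finset.sum_neg_distrib, ← Finset.sum_add_distrib]
  congr 1
  · refine Finset.sum_congr rfl fun e _ => ?_
    have h := setIntegral_Ici_deriv_star_mul hκ hl (c (.inl e)) (d (.inl e))
    simp only [edgeSol_derivCoeff]
    simp only [edgeSol, growCoeff, decayCoeff, mul_zero, interval]
    rw [h]
    simp [bdryValue, bdryDeriv, edgeSol, growCoeff, decayCoeff]
  · refine Finset.sum_congr rfl fun i _ => ?_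
    have h := setIntegral_Icc_deriv_star_mul κ l (c (.inr (.inr i))) (c (.inr (.inl i)))
      (d (.inr (.inr i))) (d (.inr (.inl i))) (G.len_pos i).le
    simp only [edgeSol_derivCoeff]
    simp only [edgeSol, growCoeff, decayCoeff, interval]
    rw [h]
    simp [bdryValue, bdryDeriv, edgeSol, growCoeff, decayCoeff, sub_eq_add_neg]

end MetricGraph

/-! ### Uniqueness for the ordinary differential equation f'' = κ²f. -/

theorem AbsolutelyContinuousOnInterval.eq_exp_of_ae_hasDerivAt {g : ℝ → ℂ} {κ x : ℝ} (hx : 0 ≤ x)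
    (hg : AbsolutelyContinuousOnInterval g 0 x)
    (hd : ∀ᵐ y, y ∈ Icc 0 x → HasDerivAt g (κ * g y) y) :
    g x = g 0 * Real.exp (κ * x) := by
  -- `expSol κ 0 1` is the integrating factor e^{-κx}; its product with `g` is absolutely continuous
  -- with derivative zero almost everywhere, hence constant.
  have hE : AbsolutelyContinuousOnInterval (expSol κ 0 1) 0 x :=
    (contDiff_expSol κ 0 1).contDiffOn.absolutelyContinuousOnInterval
  obtain ⟨C, hC⟩ := (hE.smul hg).const_of_ae_hasDerivAt_zero (by
    filter_upwards [hd] with y hy hyx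
    rw [uIcc_of_le hx] at hyx
    refine ((hasDerivAt_expSol κ 0 1 y).smul (hy hyx)).congr_deriv ?_
    simp only [expSol, smul_eq_mul]
    ring)
  have h0 := hC 0 left_mem_uIcc
  have h1 := (hC x right_mem_uIcc).trans h0.symm
  simp only [expSol, Pi.smul_apply', smul_eq_mul, zero_mul, zero_add, one_mul, mul_zero, neg_zero,
    Real.exp_zero, Complex.ofReal_one] at h1
  rw [← h1, mul_right_comm, ← Complex.ofReal_mul, ← Real.exp_add]
  simp

/-- The combinations κf ± f' solve the first-order equations g' = ±κg. -/
theorem HasTwoDerivsOn.eq_expSol {S : Set ℝ} {f f' f'' : ℝ → ℂ} {κ : ℝ} (hκ : 0 < κ)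
    (h : HasTwoDerivsOn S f f' f'') (hS : ∀ x ∈ S, 0 ≤ x ∧ Icc 0 x ⊆ S) (hm : MeasurableSet S)
    (hf : f'' =ᵐ[volume.restrict S] fun x => (κ : ℂ) ^ 2 * f x)
    (hint : ∀ᵐ x ∂volume.restrict S, x ∈ interior S) :
    ∀ x ∈ S,
      f x = expSol κ ((κ * f 0 + f' 0) / (2 * κ)) ((κ * f 0 - f' 0) / (2 * κ)) x ∧
      f' x = expSol κ (κ * ((κ * f 0 + f' 0) / (2 * κ))) (-κ * ((κ * f 0 - f' 0) / (2 * κ))) x := by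
  intro x hx
  have hκ' : (κ : ℂ) ≠ 0 := by exact_mod_cast hκ.ne'
  obtain ⟨hx0, hxS⟩ := hS x hx
  have h0 : (0 : ℝ) ∈ S := hxS ⟨le_rfl, hx0⟩
  have hae : ∀ᵐ y, y ∈ S → HasDerivAt f (f' y) y ∧ HasDerivAt f' (κ ^ 2 * f y) y := by
    rw [← ae_restrict_iff' hm]
    filter_upwards [h.deriv_deriv, hf, hint] with y h1 h2 h3
    exact ⟨(h.deriv y (interior_subset h3)).hasDerivAt (mem_interior_iff_mem_nhds.1 h3), h2 ▸ h1⟩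
  have hp := ((h.ac 0 h0 x hx).const_smul (κ : ℂ)).add (h.ac_deriv 0 h0 x hx)
  have hq := ((h.ac 0 h0 x hx).const_smul (κ : ℂ)).sub (h.ac_deriv 0 h0 x hx)
  have ep := hp.eq_exp_of_ae_hasDerivAt (κ := κ) hx0 (by
    filter_upwards [hae] with y hy hyx
    obtain ⟨h1, h2⟩ := hy (hxS hyx)
    refine ((h1.const_smul (κ : ℂ)).add h2).congr_deriv ?_
    simp only [Pi.add_apply, smul_eq_mul]
    ring)
  have eq := hq.eq_exp_of_ae_hasDerivAt (κ := -κ) hx0 (by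
    filter_upwards [hae] with y hy hyx
    obtain ⟨h1, h2⟩ := hy (hxS hyx)
    refine ((h1.const_smul (κ : ℂ)).sub h2).congr_deriv ?_
    simp only [Pi.sub_apply, smul_eq_mul]
    push_cast
    ring)
  simp only [Pi.add_apply, Pi.sub_apply, smul_eq_mul, neg_mul] at ep eq
  simp only [expSol]
  constructor
  · field_simp
    linear_combination ep + eq
  · field_simp
    linear_combination ep - eq

/-- After removal of the decaying part, |ae^{κx}| ≥ |a| would put a constant in L² of a half-line.
-/
theorem eq_zero_of_memLp_expSol_Ici {κ : ℝ} (hκ : 0 < κ) {a b : ℂ}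
    (h : MemLp (expSol κ a b) 2 (volume.restrict (Ici 0))) : a = 0 := by
  have h1 : MemLp (expSol κ a 0) 2 (volume.restrict (Ici 0)) := by
    have h2 := h.sub (memLp_expSol_Ici hκ b)
    convert h2 using 1
    ext x
    simp [expSol]
  have h2 : MemLp (fun _ : ℝ => a) 2 (volume.restrict (Ici (0 : ℝ))) := by
    refine h1.mono aestronglyMeasurable_const ?_
    filter_upwards [ae_restrict_mem measurableSet_Ici] with x hx
    have hx' : (0 : ℝ) ≤ x := hx
    simp only [expSol, zero_mul, add_zero, norm_mul, Complex.norm_real, Real.norm_eq_abs,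
      Real.abs_exp]
    exact le_mul_of_one_le_right (norm_nonneg _) (Real.one_le_exp (by positivity))
  rcases (memLp_const_iff (by norm_num) (by norm_num)).1 h2 with h3 | h3
  · exact h3
  · simp at h3

theorem expSol_eq_zero {κ s : ℝ} (hκ : 0 < κ) (hs : 0 < s) {a b : ℂ} (h0 : expSol κ a b 0 = 0)
    (h1 : expSol κ a b s = 0) : a = 0 ∧ b = 0 := by
  have hb : b = -a := by
    simp only [expSol, mul_zero, neg_zero, Real.exp_zero, Complex.ofReal_one, mul_one] at h0
    linear_combination h0
  subst hb
  have hlt : Real.exp (-(κ * s)) < Real.exp (κ * s) := by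
    have := mul_pos hκ hs
    exact Real.exp_lt_exp.2 (by linarith)
  have h2 : a * ((Real.exp (κ * s) - Real.exp (-(κ * s)) : ℝ) : ℂ) = 0 := by
    simp only [expSol] at h1
    rw [Complex.ofReal_sub]
    linear_combination h1
  rcases mul_eq_zero.1 h2 with h3 | h3
  · simp [h3]
  · exact absurd (Complex.ofReal_eq_zero.1 h3) (by linarith)

/-! ### Eigenspaces as spaces of coefficients. -/

namespace MetricGraph

variable {V E I : Type*} (G : MetricGraph V E I)

theorem measurableSet_interval (j : E ⊕ I) : MeasurableSet (G.interval j) := by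
  rcases j with e | i
  · exact measurableSet_Ici
  · exact measurableSet_Icc

theorem Icc_subset_interval (j : E ⊕ I) :
    ∀ x ∈ G.interval j, 0 ≤ x ∧ Icc 0 x ⊆ G.interval j := by
  rcases j with e | i
  · exact fun x hx => ⟨hx, fun y hy => hy.1⟩
  · exact fun x hx => ⟨hx.1, fun y hy => ⟨hy.1, hy.2.trans hx.2⟩⟩

theorem ae_mem_interior_interval (j : E ⊕ I) :
    ∀ᵐ x ∂volume.restrict (G.interval j), x ∈ interior (G.interval j) := by
  have h : interior (G.interval j) =ᵐ[volume] G.interval j := by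
    rcases j with e | i
    · rw [interval, interior_Ici]
      exact Ioi_ae_eq_Ici
    · rw [interval, interior_Icc]
      exact Ioo_ae_eq_Icc
  rw [← Measure.restrict_congr_set h]
  exact ae_restrict_mem isOpen_interior.measurableSet

theorem hasTwoDerivsOn_edgeSol {κ : ℝ} {c : BdrySpace E I} {j : E ⊕ I} {η : ℝ → ℂ}
    (hη : η =ᵐ[volume.restrict (G.interval j)] edgeSol κ (derivCoeff κ (derivCoeff κ c)) j) :
    HasTwoDerivsOn (G.interval j) (edgeSol κ c j) (edgeSol κ (derivCoeff κ c) j) η where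
  ac _ _ _ _ := (contDiff_expSol _ _ _).contDiffOn.absolutelyContinuousOnInterval
  deriv x _ := (hasDerivAt_edgeSol κ c j x).hasDerivWithinAt
  ac_deriv _ _ _ _ := (contDiff_expSol _ _ _).contDiffOn.absolutelyContinuousOnInterval
  deriv_deriv := by
    filter_upwards [hη] with x hx
    rw [hx]
    exact hasDerivAt_edgeSol κ _ j x

theorem solVec_mem_laplacianGraph {κ : ℝ} (hκ : 0 < κ)
    {M : Submodule ℂ (BdrySpace E I × BdrySpace E I)} {c : BdrySpace E I}
    (hc : G.bdryData κ c ∈ M) :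
    (G.solVec hκ c, ((κ : ℂ) ^ 2) • G.solVec hκ c) ∈ G.laplacianGraph M := by
  refine ⟨edgeSol κ c, edgeSol κ (derivCoeff κ c), fun j => G.coeFn_solVec hκ c j, fun j => ?_, hc⟩
  refine G.hasTwoDerivsOn_edgeSol ?_
  rw [derivCoeff_derivCoeff, ← map_smul]
  exact G.coeFn_solVec hκ _ j

theorem exists_solVec_of_mem_laplacianGraph {κ : ℝ} (hκ : 0 < κ)
    {M : Submodule ℂ (BdrySpace E I × BdrySpace E I)} {ψ : G.L2Space}
    (h : (ψ, ((κ : ℂ) ^ 2) • ψ) ∈ G.laplacianGraph M) :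
    ∃ c, G.bdryData κ c ∈ M ∧ G.solVec hκ c = ψ := by
  obtain ⟨f, f', hrep, hder, hbdry⟩ := h
  have hη : ∀ j, ((((κ : ℂ) ^ 2) • ψ) j : ℝ → ℂ) =ᵐ[volume.restrict (G.interval j)]
      fun x => (κ : ℂ) ^ 2 * f j x := by
    intro j
    filter_upwards [Lp.coeFn_smul ((κ : ℂ) ^ 2) (ψ j), hrep j] with x h1 h2
    refine h1.trans ?_
    rw [Pi.smul_apply, h2, smul_eq_mul]
  have hsol := fun j => (hder j).eq_expSol hκ (G.Icc_subset_interval j)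
    (G.measurableSet_interval j) (hη j) (G.ae_mem_interior_interval j)
  set α : E ⊕ I → ℂ := fun j => (κ * f j 0 + f' j 0) / (2 * κ) with hα
  set β : E ⊕ I → ℂ := fun j => (κ * f j 0 - f' j 0) / (2 * κ) with hβ
  let c : BdrySpace E I := fun k => match k with
    | .inl e => β (.inl e)
    | .inr (.inl i) => β (.inr i)
    | .inr (.inr i) => α (.inr i)
  -- Square integrability excludes growth on external edges.
  have hα0 : ∀ e, α (.inl e) = 0 := by
    intro e
    refine eq_zero_of_memLp_expSol_Ici hκ (b := β (.inl e)) ?_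
    refine (memLp_congr_ae ?_).1 (Lp.memLp (ψ (.inl e)))
    filter_upwards [hrep (.inl e), ae_restrict_mem (G.measurableSet_interval (.inl e))] with x h1 h2
    exact h1.trans (hsol (.inl e) x h2).1
  have hc : ∀ j, growCoeff c j = α j ∧ decayCoeff c j = β j := by
    rintro (e | i)
    · exact ⟨(hα0 e).symm, rfl⟩
    · exact ⟨rfl, rfl⟩
  have hf : ∀ j, ∀ x ∈ G.interval j, edgeSol κ c j x = f j x := by
    intro j x hx
    rw [edgeSol, (hc j).1, (hc j).2]
    exact (hsol j x hx).1.symm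
  have hf' : ∀ j, ∀ x ∈ G.interval j, edgeSol κ (derivCoeff κ c) j x = f' j x := by
    intro j x hx
    rw [edgeSol_derivCoeff, (hc j).1, (hc j).2]
    exact (hsol j x hx).2.symm
  have m0 : ∀ i, (0 : ℝ) ∈ G.interval (.inr i : E ⊕ I) := fun i => ⟨le_rfl, (G.len_pos i).le⟩
  have m1 : ∀ i, G.len i ∈ G.interval (.inr i : E ⊕ I) := fun i => ⟨(G.len_pos i).le, le_rfl⟩
  have m2 : ∀ e, (0 : ℝ) ∈ G.interval (.inl e : E ⊕ I) := fun e => self_mem_Ici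
  refine ⟨c, ?_, ?_⟩
  · convert hbdry using 1
    refine Prod.ext ?_ ?_ <;> ext k <;> rcases k with e | i | i
    · exact hf _ _ (m2 e)
    · exact hf _ _ (m0 i)
    · exact hf _ _ (m1 i)
    · exact hf' _ _ (m2 e)
    · exact hf' _ _ (m0 i)
    · exact congrArg Neg.neg (hf' _ _ (m1 i))
  · refine PiLp.ext fun j => Lp.ext ?_
    filter_upwards [G.coeFn_solVec hκ c j, hrep j, ae_restrict_mem (G.measurableSet_interval j)]
      with x h1 h2 h3
    rw [h1, h2, hf j x h3]

theorem solVec_injective {κ : ℝ} (hκ : 0 < κ) : Function.Injective (G.solVec (E := E) hκ) := by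
  rw [injective_iff_map_eq_zero]
  intro c hc
  have h : ∀ j, EqOn (edgeSol κ c j) 0 (G.interval j) := by
    intro j
    refine Measure.eqOn_of_ae_eq (μ := volume) ?_ (continuous_expSol _ _ _).continuousOn
      continuousOn_const (G.interval_subset_closure_interior j)
    refine (G.coeFn_solVec hκ c j).symm.trans ?_
    rw [hc]
    exact Lp.coeFn_zero _ _ _
  have hi : ∀ i, c (.inr (.inr i)) = 0 ∧ c (.inr (.inl i)) = 0 := fun i =>
    expSol_eq_zero hκ (G.len_pos i) (h (.inr i) ⟨le_rfl, (G.len_pos i).le⟩)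
      (h (.inr i) ⟨(G.len_pos i).le, le_rfl⟩)
  ext k
  rcases k with e | i | i
  · have := h (.inl e) self_mem_Ici
    simpa [edgeSol, expSol, growCoeff, decayCoeff] using this
  · exact (hi i).2
  · exact (hi i).1

theorem eigenspaceAt_neg_laplacian {κ : ℝ} (hκ : 0 < κ)
    (M : Submodule ℂ (BdrySpace E I × BdrySpace E I)) :
    (-(G.laplacian M)).eigenspaceAt (((-κ ^ 2 : ℝ)) : ℂ) =
      (M.comap (G.bdryData κ)).map (G.solVec hκ) := by
  have key : ∀ ψ : G.L2Space, ψ ∈ (-(G.laplacian M)).eigenspaceAt (((-κ ^ 2 : ℝ)) : ℂ) ↔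
      (ψ, ((κ : ℂ) ^ 2) • ψ) ∈ G.laplacianGraph M := by
    intro ψ
    rw [← G.laplacian_graph, LinearPMap.mem_graph_iff]
    refine exists_congr fun y => and_congr_right fun hy => ?_
    rw [LinearPMap.neg_apply, neg_eq_iff_eq_neg, ← neg_smul]
    push_cast
    rw [neg_neg]
  ext ψ
  rw [key]
  constructor
  · intro h
    obtain ⟨c, h1, h2⟩ := G.exists_solVec_of_mem_laplacianGraph hκ h
    exact ⟨c, h1, h2⟩
  · rintro ⟨c, h1, rfl⟩
    exact G.solVec_mem_laplacianGraph hκ h1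

theorem rank_eigenspaceAt_neg_laplacian {κ : ℝ} (hκ : 0 < κ)
    (M : Submodule ℂ (BdrySpace E I × BdrySpace E I)) :
    Module.rank ℂ ((-(G.laplacian M)).eigenspaceAt (((-κ ^ 2 : ℝ)) : ℂ)) =
      Module.rank ℂ (M.comap (G.bdryData κ)) := by
  rw [G.eigenspaceAt_neg_laplacian hκ]
  exact (Submodule.equivMapOfInjective _ (G.solVec_injective hκ) _).rank_eq.symm

end MetricGraph

/-! ### The upper bound. -/

namespace MetricGraph

variable {V E I : Type*} [Fintype E] [Fintype I] (G : MetricGraph V E I)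

theorem star_bdryData_dotProduct {κ l : ℝ} (hκ : 0 < κ) (hl : 0 < l) (c d : BdrySpace E I) :
    star (G.bdryData κ c).1 ⬝ᵥ (G.bdryData l d).2 =
      -(inner ℂ (G.solVec hκ (derivCoeff κ c)) (G.solVec hl (derivCoeff l d)) +
        (l : ℂ) ^ 2 * inner ℂ (G.solVec hκ c) (G.solVec hl d)) := by
  have h := G.star_bdryValue_dotProduct_bdryDeriv hκ hl c (derivCoeff l d)
  rw [derivCoeff_derivCoeff, map_smul, inner_smul_right] at h
  exact h

/-- In ω the scalar products of the derivatives cancel, leaving (κ² - l²)⟨ψ, φ⟩. -/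
theorem inner_solVec_eq_zero {κ l : ℝ} (hκ : 0 < κ) (hl : 0 < l) (hne : κ ≠ l)
    {c d : BdrySpace E I} (h : symplecticForm (G.bdryData κ c) (G.bdryData l d) = 0) :
    inner ℂ (G.solVec hκ c) (G.solVec hl d) = 0 := by
  have h1 := G.star_bdryData_dotProduct hκ hl c d
  have h2 := congrArg star (G.star_bdryData_dotProduct hl hκ d c)
  rw [← star_dotProduct, star_neg, star_add, star_mul', Complex.star_def, inner_conj_symm,
    inner_conj_symm, map_pow, Complex.conj_ofReal] at h2
  rw [symplecticForm_eq, h1, h2] at h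
  have h3 : ((κ : ℂ) ^ 2 - (l : ℂ) ^ 2) * inner ℂ (G.solVec hκ c) (G.solVec hl d) = 0 := by
    linear_combination h
  refine (mul_eq_zero.1 h3).resolve_left fun h4 => hne ?_
  have h5 : κ ^ 2 = l ^ 2 := by exact_mod_cast sub_eq_zero.1 h4
  exact (sq_eq_sq₀ hκ.le hl.le).1 h5

theorem re_star_sum_bdryData_dotProduct_neg {ι : Type*} {κ : ι → ℝ} (hκ : ∀ i, 0 < κ i)
    (hinj : Function.Injective κ) {M : Submodule ℂ (BdrySpace E I × BdrySpace E I)}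
    (hM : IsIsotropic M) (s : Finset ι) (c : ι → BdrySpace E I)
    (hc : ∀ i, G.bdryData (κ i) (c i) ∈ M) {k : ι} (hk : k ∈ s) (hck : c k ≠ 0) :
    (star (∑ i ∈ s, G.bdryData (κ i) (c i)).1 ⬝ᵥ
      (∑ i ∈ s, G.bdryData (κ i) (c i)).2).re < 0 := by
  classical
  set w := ∑ i ∈ s, G.solVec (hκ i) (derivCoeff (κ i) (c i)) with hw
  have hdiag : ∀ i ∈ s, ∑ j ∈ s, ((κ j : ℂ) ^ 2 *
      inner ℂ (G.solVec (hκ i) (c i)) (G.solVec (hκ j) (c j))) =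
      ((κ i ^ 2 * ‖G.solVec (hκ i) (c i)‖ ^ 2 : ℝ) : ℂ) := by
    intro i hi
    rw [Finset.sum_eq_single_of_mem i hi]
    · rw [inner_self_eq_norm_sq_to_K]
      push_cast
      rfl
    · intro j _ hji
      rw [G.inner_solVec_eq_zero (hκ i) (hκ j) (fun h => hji (hinj h).symm)
        (hM _ (hc i) _ (hc j)), mul_zero]
  have key : star (∑ i ∈ s, G.bdryData (κ i) (c i)).1 ⬝ᵥ (∑ i ∈ s, G.bdryData (κ i) (c i)).2 =
      ((-(‖w‖ ^ 2 + ∑ i ∈ s, κ i ^ 2 * ‖G.solVec (hκ i) (c i)‖ ^ 2) : ℝ) : ℂ) := by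
    rw [Prod.fst_sum, Prod.snd_sum, star_sum, sum_dotProduct]
    simp only [dotProduct_sum, G.star_bdryData_dotProduct (hκ _) (hκ _)]
    simp only [Finset.sum_neg_distrib, Finset.sum_add_distrib]
    rw [Finset.sum_congr rfl hdiag]
    -- Derivatives for distinct κ need not be orthogonal, but their double sum is a single squared
    -- norm.
    have hww : ∑ i ∈ s, ∑ j ∈ s, inner ℂ (G.solVec (hκ i) (derivCoeff (κ i) (c i)))
        (G.solVec (hκ j) (derivCoeff (κ j) (c j))) = ((‖w‖ ^ 2 : ℝ) : ℂ) := by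
      rw [← Finset.sum_congr rfl fun i _ => inner_sum s _ _, ← sum_inner, ← hw,
        inner_self_eq_norm_sq_to_K]
      push_cast
      rfl
    rw [hww, ← Complex.ofReal_sum]
    push_cast
    rfl
  rw [key, Complex.ofReal_re, neg_lt_zero]
  refine add_pos_of_nonneg_of_pos (by positivity)
    (Finset.sum_pos' (fun i _ => by positivity) ⟨k, hk, ?_⟩)
  have h1 : G.solVec (hκ k) (c k) ≠ 0 := fun h =>
    hck (G.solVec_injective (hκ k) (h.trans (map_zero _).symm))
  have h2 := hκ k
  positivity

/-- The sum is the rank of the direct sum of the coefficient spaces, which `Φ` sends to boundary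
data. Negativity of the form off zero makes `Φ` injective with negative definite range. -/
theorem sum_rank_comap_bdryData_le [DecidableEq E] [DecidableEq I] {ι : Type} {κ : ι → ℝ}
    (hκ : ∀ i, 0 < κ i) (hinj : Function.Injective κ)
    {A B : Matrix (BdryIdx E I) (BdryIdx E I) ℂ}
    (hM : IsMaximalIsotropic (boundarySubspace A B)) :
    (Cardinal.sum fun i => Module.rank ℂ ((boundarySubspace A B).comap (G.bdryData (κ i)))) ≤
      (numPosEigenvalues (A * Bᴴ) : Cardinal) := by
  classical
  set M := boundarySubspace A B with hMdef
  let S : ι → Submodule ℂ (BdrySpace E I) := fun i => M.comap (G.bdryData (κ i))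
  let Φ : (DirectSum ι fun i => S i) →ₗ[ℂ] BdrySpace E I × BdrySpace E I :=
    DirectSum.toModule ℂ ι _ fun i => (G.bdryData (κ i)).domRestrict (S i)
  have hΦ : ∀ x, Φ x = ∑ i ∈ x.support, G.bdryData (κ i) (x i) := by
    intro x
    conv_lhs => rw [← DirectSum.sum_support_of x, map_sum]
    refine Finset.sum_congr rfl fun i _ => ?_
    exact DirectSum.toModule_lof (M := fun i => S i) (φ := fun i =>
      (G.bdryData (κ i)).domRestrict (S i)) ℂ i (x i)
  have hmem : ∀ x, Φ x ∈ M := fun x => by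
    rw [hΦ]
    exact M.sum_mem fun i _ => (x i).2
  have hneg : ∀ x, x ≠ 0 → (star (Φ x).1 ⬝ᵥ (Φ x).2).re < 0 := by
    intro x hx
    obtain ⟨k, hk⟩ : ∃ k, k ∈ x.support := by
      by_contra! h
      exact hx (DFinsupp.support_eq_empty.1 (Finset.eq_empty_of_forall_notMem h))
    rw [hΦ]
    refine G.re_star_sum_bdryData_dotProduct_neg hκ hinj hM.prop x.support (fun i => (x i : _))
      (fun i => (x i).2) hk fun h => DFinsupp.mem_support_iff.1 hk (Subtype.ext h)
  have hΦinj : Function.Injective Φ := by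
    rw [injective_iff_map_eq_zero]
    intro x hx
    by_contra hne
    have := hneg x hne
    simp [hx] at this
  have hW := finrank_le_numPosEigenvalues hM (W := LinearMap.range Φ)
    (by rintro _ ⟨x, rfl⟩; exact hmem x) (by
      rintro _ ⟨x, rfl⟩ hne
      exact hneg x fun h => hne (by rw [h, map_zero]))
  change (Cardinal.sum fun i => Module.rank ℂ (S i)) ≤ _
  rw [← rank_directSum, (LinearEquiv.ofInjective Φ hΦinj).rank_eq, ← Module.finrank_eq_rank]
  exact_mod_cast hW

omit [Fintype E] [Fintype I] in
theorem bdryData_of_isEmpty [IsEmpty I] (κ : ℝ) (c : BdrySpace E I) :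
    G.bdryData κ c = (c, (-κ : ℂ) • c) := by
  refine Prod.ext ?_ ?_ <;> ext k <;> rcases k with e | i | i
  · simp [bdryData, bdryValue, edgeSol, expSol, growCoeff, decayCoeff]
  · exact isEmptyElim i
  · exact isEmptyElim i
  · simp [bdryData, bdryDeriv, edgeSol, expSol, growCoeff, decayCoeff, derivCoeff]
  · exact isEmptyElim i
  · exact isEmptyElim i

end MetricGraph

universe uE uI

/-! ### The operator part of `M`, giving the lower bound. -/

section OperatorPart

variable {E : Type uE} {I : Type uI} [Fintype E] [Fintype I]

/-- A maximal isotropic subspace contains the graph of a symmetric operator, its operator part,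
whose form is the one of the subspace. -/
theorem IsMaximalIsotropic.exists_operatorPart
    {M : Submodule ℂ (BdrySpace E I × BdrySpace E I)} (hM : IsMaximalIsotropic M) :
    ∃ (U : Submodule ℂ (EuclideanSpace ℂ (BdryIdx E I))) (L : U →ₗ[ℂ] U) (f : M →ₗ[ℂ] U),
      LinearMap.IsSymmetric (𝕜 := ℂ) (E := U) L ∧ (∀ u : U, ((u : EuclideanSpace ℂ _).ofLp,
        (L u : EuclideanSpace ℂ _).ofLp) ∈ M) ∧ (∀ p : M, (f p : EuclideanSpace ℂ _).ofLp = p.1.1) ∧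
      ∀ p : M, inner ℂ (f p) (L (f p)) = star p.1.1 ⬝ᵥ p.1.2 := by
  let F : M →ₗ[ℂ] EuclideanSpace ℂ (BdryIdx E I) :=
    (WithLp.linearEquiv 2 ℂ (BdryIdx E I → ℂ)).symm.toLinearMap ∘ₗ
      (LinearMap.fst ℂ _ _).domRestrict M
  let f := F.rangeRestrict
  have hfp : ∀ p : M, (f p : EuclideanSpace ℂ _).ofLp = p.1.1 := fun p => rfl
  obtain ⟨g, hg⟩ := f.exists_rightInverse_of_surjective F.range_rangeRestrict
  have hgf : ∀ u, f (g u) = u := fun u => LinearMap.congr_fun hg u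
  -- Lift u to some (u, v) in `M` by the section `g`, then project v orthogonally back to the space
  -- of first components.
  let L : LinearMap.range F →ₗ[ℂ] LinearMap.range F :=
    (LinearMap.range F).orthogonalProjectionOnto.toLinearMap ∘ₗ
      (WithLp.linearEquiv 2 ℂ (BdryIdx E I → ℂ)).symm.toLinearMap ∘ₗ
      LinearMap.snd ℂ _ _ ∘ₗ M.subtype ∘ₗ g
  have hinner : ∀ x y : LinearMap.range F, inner ℂ x y =
      star (x : EuclideanSpace ℂ (BdryIdx E I)).ofLp ⬝ᵥ
        (y : EuclideanSpace ℂ (BdryIdx E I)).ofLp := fun x y => by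
    rw [Submodule.coe_inner, EuclideanSpace.inner_eq_star_dotProduct, dotProduct_comm]
  have hgraph : ∀ u : LinearMap.range F, ((u : EuclideanSpace ℂ (BdryIdx E I)).ofLp,
      (L u : EuclideanSpace ℂ (BdryIdx E I)).ofLp) ∈ M := by
    intro u
    set v : EuclideanSpace ℂ (BdryIdx E I) := WithLp.toLp 2 (g u).1.2 with hv
    have hperp : v - L u ∈ (LinearMap.range F)ᗮ :=
      Submodule.sub_starProjection_mem_orthogonal v
    -- A vector orthogonal to all first components gives a pair (0, ·) that is ω-orthogonal to `M`,
    -- hence in `M`; subtracting it from (u, v) leaves (u, Lu).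
    have hmem : ((0, (v - L u).ofLp) : BdrySpace E I × BdrySpace E I) ∈ M := by
      refine hM.mem_of_forall_symplecticForm fun q hq => ?_
      have h := (Submodule.mem_orthogonal' _ _).1 hperp _ (f ⟨q, hq⟩).2
      rw [EuclideanSpace.inner_eq_star_dotProduct, dotProduct_comm] at h
      rw [symplecticForm_eq, star_zero, zero_dotProduct, zero_sub, neg_eq_zero]
      exact h
    have h := M.sub_mem (g u).2 hmem
    have hu : (u : EuclideanSpace ℂ (BdryIdx E I)).ofLp = (g u).1.1 := by
      rw [← hfp, hgf]
    convert h using 1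
    refine Prod.ext ?_ ?_
    · simp [hu]
    · simp [hv]
  refine ⟨LinearMap.range F, L, f, ?_, hgraph, hfp, ?_⟩
  · intro x y
    have h := hM.prop _ (hgraph x) _ (hgraph y)
    rw [symplecticForm_eq, sub_eq_zero] at h
    rw [hinner, hinner]
    exact h.symm
  · intro p
    -- The difference has zero first component, so pairing it with `p` shows that v - Lu is
    -- orthogonal to u.
    have h := hM.prop _ (M.sub_mem p.2 (hgraph (f p))) _ p.2
    rw [symplecticForm_eq] at h
    simp only [Prod.fst_sub, Prod.snd_sub, hfp, sub_self, star_zero, zero_dotProduct, zero_sub,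
      neg_eq_zero, star_sub, sub_dotProduct] at h
    have h2 := hM.prop _ p.2 _ p.2
    rw [symplecticForm_eq, sub_eq_zero] at h2
    have h3 := congrArg star (sub_eq_zero.1 h)
    rw [← star_dotProduct, ← star_dotProduct] at h3
    rw [hinner, hfp, h3]

theorem IsMaximalIsotropic.finrank_le_sum_rank {ι : Type} {κ : ι → ℝ}
    (hsurj : ∀ r, 0 < r → ∃ i, κ i = r)
    {M : Submodule ℂ (BdrySpace E I × BdrySpace E I)} (hM : IsMaximalIsotropic M)
    {W : Submodule ℂ (BdrySpace E I × BdrySpace E I)} (hWM : W ≤ M)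
    (hW : ∀ p ∈ W, p ≠ 0 → (star p.1 ⬝ᵥ p.2).re < 0) :
    (Module.finrank ℂ W : Cardinal) ≤ Cardinal.sum fun i => Module.rank ℂ
      (M.comap (LinearMap.prod LinearMap.id ((-κ i : ℂ) • LinearMap.id))) := by
  classical
  obtain ⟨U, L, f, hL, hgraph, hf, hform⟩ := hM.exists_operatorPart
  let b := hL.eigenvectorBasis rfl
  let lam := hL.eigenvalues rfl
  have hb : ∀ i, L (b i) = (lam i : ℂ) • b i := hL.apply_eigenvectorBasis rfl
  let h : W →ₗ[ℂ] U := f ∘ₗ Submodule.inclusion hWM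
  have hneg : ∀ p : W, p ≠ 0 → (inner ℂ (h p) (L (h p))).re < 0 := by
    intro p hp
    have e : inner ℂ (h p) (L (h p)) = _ := hform (Submodule.inclusion hWM p)
    rw [e]
    exact hW p p.2 fun h0 => hp (Subtype.ext h0)
  have hh : Function.Injective h := by
    rw [injective_iff_map_eq_zero]
    intro p hp
    by_contra hne
    have := hneg p hne
    simp [hp] at this
  have hle : Module.finrank ℂ W ≤ Fintype.card {i // 0 < -lam i} := by
    rw [← LinearMap.finrank_range_of_inj hh]
    refine LinearMap.finrank_le_card_pos_of_re_inner_pos b (-L) (fun i => -lam i)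
      (fun i => ?_) _ ?_
    · rw [LinearMap.neg_apply, hb, Complex.ofReal_neg, neg_smul]
    · rintro _ ⟨p, rfl⟩ hne
      have e : inner ℂ (h p) ((-L) (h p)) = -inner ℂ (h p) (L (h p)) :=
        inner_neg_right (𝕜 := ℂ) (E := U) (h p) (L (h p))
      rw [e, Complex.neg_re]
      exact neg_pos.2 (hneg p fun h0 => hne (by rw [h0, map_zero]))
  choose idx hidx using hsurj
  -- Negative eigenvalues of `L` are sorted by their value -κ: the eigenvectors in one fibre are
  -- independent elements of the corresponding space, and the fibres partition all of them.
  let φ : {i // 0 < -lam i} → ι := fun i => idx (-lam i.1) i.2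
  have hφ : ∀ i, κ (φ i) = -lam i.1 := fun i => hidx _ i.2
  have hcard : ∀ k : ι, Cardinal.lift.{max uE uI} (Cardinal.mk {i // φ i = k}) ≤ Module.rank ℂ
      (M.comap (LinearMap.prod LinearMap.id ((-κ k : ℂ) • LinearMap.id))) := by
    intro k
    let w : {i // φ i = k} → M.comap (LinearMap.prod LinearMap.id ((-κ k : ℂ) • LinearMap.id)) :=
      fun i => ⟨(b i.1.1 : EuclideanSpace ℂ (BdryIdx E I)).ofLp, by
        have h1 := hgraph (b i.1.1)
        have h2 : (-κ k : ℂ) = lam i.1.1 := by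
          have h3 := hφ i.1
          rw [i.2] at h3
          rw [h3, Complex.ofReal_neg, neg_neg]
        rw [hb] at h1
        rw [h2]
        exact h1⟩
    have hw : LinearIndependent ℂ w := by
      have h1 : LinearIndependent ℂ fun i : {i // φ i = k} => b i.1.1 :=
        (b.orthonormal.comp (fun i : {i // φ i = k} => i.1.1)
          (Subtype.val_injective.comp Subtype.val_injective)).linearIndependent
      have h2 := (h1.map' U.subtype U.ker_subtype).map'
        (WithLp.linearEquiv 2 ℂ (BdryIdx E I → ℂ)).toLinearMap (LinearEquiv.ker _)
      exact LinearIndependent.of_comp (Submodule.subtype _) h2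
    simpa using hw.cardinal_lift_le_rank
  refine le_trans ?_ (Cardinal.sum_le_sum _ _ hcard)
  have h1 : Cardinal.mk {i // 0 < -lam i} = Cardinal.sum fun k => Cardinal.mk {i // φ i = k} := by
    rw [← Cardinal.mk_sigma]
    exact Cardinal.mk_congr (Equiv.sigmaFiberEquiv φ).symm
  rw [← Cardinal.lift_sum, ← h1, Cardinal.mk_fintype, Cardinal.lift_natCast]
  exact_mod_cast hle

end OperatorPart

theorem mainTheorem1 {V E I : Type*} [Finite V] [Fintype E] [DecidableEq E]
    [Fintype I] [DecidableEq I] (G : MetricGraph V E I)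
    (M : Submodule ℂ (BdrySpace E I × BdrySpace E I)) (hM : IsMaximalIsotropic M)
    (A B : Matrix (BdryIdx E I) (BdryIdx E I) ℂ) (hAB : boundarySubspace A B = M) :
    (-(G.laplacian M)).numNegEigenvalues ≤ (numPosEigenvalues (A * Bᴴ) : Cardinal) ∧
      (IsEmpty I →
        (-(G.laplacian M)).numNegEigenvalues = (numPosEigenvalues (A * Bᴴ) : Cardinal)) := by
  -- The substitution μ = -κ², a bijection between the negative and the positive numbers.
  let κ : Iio (0 : ℝ) → ℝ := fun μ => Real.sqrt (-μ)
  have hκ : ∀ μ, 0 < κ μ := fun μ => Real.sqrt_pos.2 (neg_pos.2 μ.2)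
  have hsq : ∀ μ : Iio (0 : ℝ), -κ μ ^ 2 = μ := fun μ => by
    rw [Real.sq_sqrt (neg_pos.2 μ.2).le, neg_neg]
  have hinj : Function.Injective κ := fun μ ν h => Subtype.ext (by rw [← hsq μ, ← hsq ν, h])
  have hnum : (-(G.laplacian M)).numNegEigenvalues =
      Cardinal.sum fun μ => Module.rank ℂ (M.comap (G.bdryData (κ μ))) := by
    unfold LinearPMap.numNegEigenvalues
    congr 1
    ext1 μ
    rw [← G.rank_eigenspaceAt_neg_laplacian (hκ μ), hsq]
  subst hAB
  have hle := G.sum_rank_comap_bdryData_le hκ hinj hM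
  rw [hnum]
  refine ⟨hle, fun hI => le_antisymm hle ?_⟩
  obtain ⟨W, hWM, hfin, hW⟩ := exists_finrank_eq_numPosEigenvalues hM
  have h := hM.finrank_le_sum_rank (κ := κ) (fun r hr =>
    ⟨⟨-r ^ 2, mem_Iio.2 (neg_lt_zero.2 (pow_pos hr 2))⟩, by simp [κ, Real.sqrt_sq hr.le]⟩) hWM hW
  have hbd : ∀ μ, G.bdryData (κ μ) =
      LinearMap.prod LinearMap.id ((-κ μ : ℂ) • LinearMap.id) :=
    fun μ => LinearMap.ext fun c => G.bdryData_of_isEmpty _ c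
  rw [hfin] at h
  refine h.trans_eq (congrArg Cardinal.sum (funext fun μ => ?_))
  rw [hbd]
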